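/- A Dyck path of length $2n$ ($n\ge 0$) is a lattice path from $(0,0)$ to $(2n,0)$ with steps $(x,y)\to(x+1,y+1)$ and $(x,y)\to(x+1,y-1)$ that never goes strictly below the $x$-axis. For such a path $P$ let $\mathrm{Area}(P)$ be the area of the region between $P$ (as a polygonal line) and the $x$-axis, and let $$C_r(n)=\sum_{P}\mathrm{Area}(P)^r,$$ the sum being over all Dyck paths $P$ of length $2n$. Then, for every $1\le r\le 20$ and every integer $n\ge 0$, $$C_r(n)=A_r(n)\,\frac{(2n)!}{n!\,(n+1)!}+B_r(n)\,4^n,$$ where $A_1,\dots,A_{20}$ and $B_1,\dots,B_{20}$ are the following polynomials with rational coefficients. $$A_{1}(n)=-2n-1,$$ $$B_{1}(n)=1.$$ $$A_{2}(n)=\frac{10}{3}n^{3}+11n^{2}+\frac{26}{3}n+2,$$ $$B_{2}(n)=-4n-2.$$ $$A_{3}(n)=-20n^{4}-60n^{3}-61n^{2}-26n-4,$$ $$B_{3}(n)=\frac{15}{4}n^{3}+\frac{75}{4}n^{2}+\frac{33}{2}n+4.$$ $$A_{4}(n)=\frac{884}{63}n^{6}+\frac{4568}{35}n^{5}+\frac{108043}{315}n^{4}+\frac{14016}{35}n^{3}+\frac{74332}{315}n^{2}+\frac{2416}{35}n+8,$$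 $$B_{4}(n)=-30n^{4}-101n^{3}-111n^{2}-50n-8.$$ $$A_{5}(n)=-\frac{8840}{63}n^{7}-\frac{53044}{63}n^{6}-\frac{128174}{63}n^{5}-\frac{162091}{63}n^{4}-\frac{116888}{63}n^{3}-\frac{48520}{63}n^{2}-\frac{3608}{21}n-16,$$ $$B_{5}(n)=\frac{565}{32}n^{6}+\frac{6495}{32}n^{5}+\frac{18485}{32}n^{4}+\frac{22825}{32}n^{3}+\frac{7035}{16}n^{2}+\frac{535}{4}n+16.$$ $$A_{6}(n)=\frac{1}{9009}\left(288288+3698016n+20486408n^{2}+63848584n^{3}+122396774n^{4}+148077150n^{5}+111243827n^{6}+48686358n^{7}+10566420n^{8}+662600n^{9}\right),$$ $$B_{6}(n)=\frac{1}{16}\left(-512-5352n-23250n^{2}-54175n^{3}-72405n^{4}-54747n^{5}-21465n^{6}-3390n^{7}\right).$$ $$A_{7}(n)=\frac{1}{1287}\left(-82368-1226976n-8085520n^{2}-30889256n^{3}-75530124n^{4}-123162974n^{5}-135119263n^{6}-98013596n^{7}-44831520n^{8}-11682480n^{9}-1325200n^{10}\right),$$ $$B_{7}(n)=\frac{1}{192}\left(12288+154032n+829860n^{2}+2519120n^{3}+4692765n^{4}+5501496n^{5}+3992625n^{6}+1687605n^{7}+355590n^{8}+19675n^{9}\right).$$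 $$A_{8}(n)=\frac{1}{43648605}\left(5587021440+94556625408n+722788288128n^{2}+3265799067264n^{3}+9701608535408n^{4}+19903358469408n^{5}+28764103449400n^{6}+29324034918864n^{7}+20768263159773n^{8}+9860607159936n^{9}+2923550216056n^{10}+458013285120n^{11}+20512504400n^{12}\right),$$ $$B_{8}(n)=\frac{1}{24}\left(-3072-44880n-288012n^{2}-1075796n^{3}-2571265n^{4}-4087230n^{5}-4368357n^{6}-3088143n^{7}-1377120n^{8}-351175n^{9}-39350n^{10}\right).$$ $$A_{9}(n)=\frac{1}{4849845}\left(-1241560320-23443002240n-204182347520n^{2}-1065215849152n^{3}-3719093291680n^{4}-9189780277040n^{5}-16492646171840n^{6}-21700974482496n^{7}-20913198712605n^{8}-14575599095610n^{9}-7139684341240n^{10}-2331148282352n^{11}-457134722640n^{12}-41025008800n^{13}\right),$$ $$B_{9}(n)=\frac{1}{22528}\left(5767168+96601344n+712490400n^{2}+3170882616n^{3}+9228947948n^{4}+18535990506n^{5}+26217829231n^{6}+26166551598n^{7}+18159348207n^{8}+8457627750n^{9}+2477024869n^{10}+390552906n^{11}+16145585n^{12}\right).$$ $$A_{10}(n)=\frac{1}{602350749}\left(308403583488+6280999801344n+63014063172480n^{2}+370990151667072n^{3}+1484820531717312n^{4}+4294799054844416n^{5}+9205357923232080n^{6}+14850760547283152n^{7}+18142055023934610n^{8}+16738899781156694n^{9}+11534090152821711n^{10}+5800502332696150n^{11}+2046998896267656n^{12}+472906579045360n^{13}+60649909311600n^{14}+2154855196000n^{15}\right),$$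 $$B_{10}(n)=\frac{1}{11264}\left(-5767168-110168320n-903428640n^{2}-4661575000n^{3}-16070004940n^{4}-38873622986n^{5}-68498378575n^{6}-88587665980n^{7}-83832753015n^{8}-57462736980n^{9}-27782166005n^{10}-9005360740n^{11}-1770064985n^{12}-161455850n^{13}\right).$$ $$A_{11}(n)=\frac{1}{54759159}\left(-56073378816-1145012405760n-13882990701312n^{2}-92003735018880n^{3}-410529795504384n^{4}-1358432365849088n^{5}-3395801783146144n^{6}-6484715304645680n^{7}-9595471281765580n^{8}-11047438656242198n^{9}-9845829544341667n^{10}-6726314202129508n^{11}-3463016884902932n^{12}-1303620856874560n^{13}-340289273520080n^{14}-55517259246400n^{15}-4309710392000n^{16}\right),$$ $$B_{11}(n)=\frac{1}{2236416}\left(2290089984+54881046528n+412604743680n^{2}+2642753179200n^{3}+10303217178800n^{4}+29244104760416n^{5}+61717377161440n^{6}+98011589235560n^{7}+117940040809305n^{8}+107142008597195n^{9}+72868944313165n^{10}+36318883656055n^{11}+12746488138475n^{12}+2955004071985n^{13}+392249111775n^{14}+13209845125n^{15}\right).$$ $$A_{12}(n)=\frac{1}{13537833083775}\left(27725482155571200+95193717781155840n+9640876052796318720n^{2}+61450013774372484096n^{3}+289086406694102382720n^{4}+1104241858081090362880n^{5}+3144421515886030314240n^{6}+6932089344157398591232n^{7}+12061727025258786041160n^{8}+16643625465714947690320n^{9}+18238950580970659970100n^{10}+15800883906134615077328n^{11}+10734575570626139091855n^{12}+5643887109431526653720n^{13}+2240482393385585306460n^{14}+644652391876146430784n^{15}+125916851551649674320n^{16}+14333661659980348800n^{17}+430012177787208000n^{18}\right),$$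 $$B_{12}(n)=\frac{1}{186368}\left(-381681664-14453913600n-68927132928n^{2}-575473561600n^{3}-2720720651280n^{4}-8466452663760n^{5}-20947581716152n^{6}-39698991916584n^{7}-57753673808545n^{8}-65588531893885n^{9}-57781616913163n^{10}-39057457298769n^{11}-19955612720225n^{12}-7494403610295n^{13}-1968378805025n^{14}-327548633475n^{15}-26419690250n^{16}\right).$$ $$A_{13}(n)=\frac{1}{1041371775675}\left(-4265458793164800+349388179496294400n-2211717031982069760n^{2}-16196159106169122816n^{3}-58209009049338684672n^{4}-253520698389934993280n^{5}-864801391384883429120n^{6}-2129265703409173570112n^{7}-4227235758204051731344n^{8}-6843287178206651226680n^{9}-8902135641538852806280n^{10}-9344457320793614331928n^{11}-7915939733110232713071n^{12}-5362839595972274356150n^{13}-2869539492494760835340n^{14}-1191030459860775140344n^{15}-372243348607709140688n^{16}-83262451078458193440n^{17}-12049845071152705600n^{18}-860024355574416000n^{19}\right),$$ $$B_{13}(n)=\frac{1}{70189056}\left(287494373376+51433490497536n-174357174583296n^{2}+952208580649728n^{3}+2855378788965888n^{4}+10319242395383184n^{5}+29926311891973856n^{6}+64856014228662384n^{7}+111796511026336188n^{8}+151944434030529855n^{9}+164615470854915795n^{10}+141353975830344108n^{11}+95133381714301892n^{12}+49707895143900210n^{13}+19747904412601290n^{14}+5712792077422860n^{15}+1129232668647912n^{16}+136456885619415n^{17}+3947823419675n^{18}\right).$$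 $$A_{14}(n)=\frac{1}{500899824099675}\left(4103371359024537600-5075047339918049894400n+23141318124490490787840n^{2}+34494577296400314169344n^{3}-14872828017438773715456n^{4}+410953567687400194534912n^{5}+1440414190806104219450240n^{6}+3760009225493072325497728n^{7}+8581741093248566402135328n^{8}+15801218257278458697597344n^{9}+23871155147948992437495240n^{10}+29518081121808798045098312n^{11}+29921040354613511920214762n^{12}+24888016214280216741338426n^{13}+16826443607846042331268065n^{14}+9143873900308913242964466n^{15}+3946467271477571595810516n^{16}+1321621683454257186307368n^{17}+328789003785047624590640n^{18}+57099159940714654197600n^{19}+6131209772718436056000n^{20}+161812267752532720000n^{21}\right),$$ $$B_{14}(n)=\frac{1}{5013504}\left(-41070624768-36522447224832n+153420116410368n^{2}-85192539937536n^{3}-1320043713649152n^{4}-1579883834781072n^{5}-7160752101380096n^{6}-19588499456466736n^{7}-36275914860061500n^{8}-58254108474395223n^{9}-75480015551145777n^{10}-78266911941012210n^{11}-65689095338586044n^{12}-44219379534285850n^{13}-23566464408081870n^{14}-9780679504318848n^{15}-3073829749644864n^{16}-698057164235559n^{17}-104393856706505n^{18}-7895646839350n^{19}\right).$$ $$A_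{15}(n)=\frac{1}{100179964819935}\left(-1641348543609815040+12577033819127718420480n-40372464466964520161280n^{2}-157497172733276438611968n^{3}+225209835690737015036928n^{4}+152813902056741785650688n^{5}-1628499099871749902572800n^{6}-2782979867963563434004096n^{7}-5946011269947035880772544n^{8}-14302692533444240386031584n^{9}-24264896882385005958209840n^{10}-33907419060322795016056664n^{11}-40452325721007292236628796n^{12}-39944708661097493843633966n^{13}-32610905619001405526486335n^{14}-22008706972081802280212252n^{15}-12157917775646526445315048n^{16}-5425914429192623312260848n^{17}-1920858163466094794542720n^{18}-524001421309111216123200n^{19}-105086586510275147376000n^{20}-14107079397815745120000n^{21}-970873606515196320000n^{22}\right),$$ $$B_{15}(n)=\frac{1}{561512448}\left(9199819948032+105279470570373120n-805117194337075200n^{2}+1533937767823918080n^{3}-332026355862620160n^{4}-315193220451079488n^{5}+3942980637812321280n^{6}+7295498029698984560n^{7}+17824986284751723840n^{8}+31453100119701153940n^{9}+47094273435281326800n^{10}+58291737399457299465n^{11}+58280189713868216640n^{12}+48038882295378751175n^{13}+32392328912022226560n^{14}+17544681573165902410n^{15}+7557834464649131040n^{16}+2551842853993223490n^{17}+644739181103490480n^{18}+113289660518686925n^{19}+13264686690108000n^{20}+341769247961875n^{21}\right).$$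 $$A_{16}(n)=\frac{1}{2649259169663181075}\left(86810924471523117465600-9682231805963656089002311680n+67714215546238089643462164480n^{2}+21103993912454048703938494464n^{3}-297166474925292939948955754496n^{4}+209342372431464612771781951488n^{5}+301816479572794020172473102336n^{6}-10656712609757525071153459200n^{7}+678907880130924205274796275968n^{8}+1527008735036946176381558516736n^{9}+2953562335170384260122489146112n^{10}+4767875485123843955021282439936n^{11}+6340883183606060580917498998432n^{12}+7311577399093565409969337362624n^{13}+7049522455630951503397270218448n^{14}+5660754567015025235116157962272n^{15}+3819952064878074341292082207891n^{16}+2143455217851430166206337762112n^{17}+983682026784128791681580851984n^{18}+365276345008049034472104584448n^{19}+107934041369584963322883596320n^{20}+24195544475714653387660876800n^{21}+3843396155784968176175008000n^{22}+410796040388709866918400000n^{23}+9820845252824331712480000n^{24}\right),$$ $$B_{16}(n)=\frac{1}{35094528}\left(-1149977493504-86184070096158720n+580137148355788800n^{2}-188406200219120640n^{3}-2481067722947051520n^{4}+3161443365715521600n^{5}+40502667725838976n^{6}-5521627246233726320n^{7}-2115070984319476960n^{8}-8220530318472988100n^{9}-15996818593246732424n^{10}-20858639241365992521n^{11}-24670928658238741970n^{12}-24344604192012549095n^{13}-19722426122704661230n^{14}-13244050115162988362n^{15}-7299917076752700980n^{16}-3261132907258501170n^{17}-1161520677781685060n^{18}-320459956025754125n^{19}-65581066387262650n^{20}-9184893708033875n^{21}-683538495923750n^{22}\right).$$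 $$A_{17}(n)=\frac{1}{155838774686069475}\left(-10213049937826249113600+7984963123982696241849139200n-49353274485740999588800757760n^{2}-119759472225996956501352431616n^{3}+321177716546971001520812064768n^{4}+273866689280312630345479225344n^{5}-870259906258157783831301353472n^{6}+20160055271152763685581574144n^{7}+708621587943810428262573137408n^{8}-813369316824028357154143054592n^{9}-996471340317246215623516793344n^{10}-1041659308531026352420188957056n^{11}-2064719769455086528722330292672n^{12}-2712797280642604768543807249568n^{13}-2906251778946914691503482401856n^{14}-2749309584485760688394668523456n^{15}-2200484813782335885689714692627n^{16}-1481689251188763804778343539814n^{17}-839471019881481237405908449168n^{18}-396125736630137255987530070816n^{19}-153817240235786688531342840352n^{20}-48290645871626191702327622720n^{21}-11900029631907242170381676800n^{22}-2205033174258316921110848000n^{23}-283684872178630909658080000n^{24}-19641690505648663424960000n^{25}\right),$$ $$B_{17}(n)=\frac{1}{7621243305984}\left(499465801300967424+569244209678459116978176n-6914984044954892885655552n^{2}+16108163926984485542817792n^{3}-9233560632771123498169344n^{4}-10059255840703245951861504n^{5}+16202442827688669170063808n^{6}-6513227519568524324282944n^{7}+5920367169414625701643760n^{8}+7422775029828482245133872n^{9}+13204749896894678690706644n^{10}+26392616595363577570580052n^{11}+31910162004767184668965361n^{12}+36159243852541455699302312n^{13}+35444376213648310358746190n^{14}+28199836215730241287912060n^{15}+18832078314054778439637311n^{16}+10589921997964820177089632n^{17}+4881287309469930891003560n^{18}+1811591725692440798695820n^{19}+541542258140728361385407n^{20}+125072812048058106346312n^{21}+19828926602965968877910n^{22}+2388415440692982252900n^{23}+56273155681006594625n^{24}\right).$$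 $$A_{18}(n)=\frac{1}{6101243867734306015725}\left(799702236231670958093107200-9163967842800901678905699110092800n+139729196894846508070012337591255040n^{2}-42727235495950379752386584289509376n^{3}-600197462369109446501597929165946880n^{4}+616046105653656514621149369219366912n^{5}+367424838941846273782210916827250688n^{6}-720794662932878471542527652702273536n^{7}+221072324222610744062152871946095616n^{8}+137987857320331701477688508864416768n^{9}+62095117481100113488288290773273856n^{10}+317059022837786069128020167927103744n^{11}+314645060919929652233649820305167232n^{12}+582377001804377380762613574254448384n^{13}+761303666740233605976156890876808864n^{14}+765069204055520784859471185833253024n^{15}+713355644605058692132500222298269258n^{16}+572551515491857269198998163166638630n^{17}+383241781545552193052996567002398927n^{18}+218658579320594482612658912724063894n^{19}+106246752315979953905569260977105424n^{20}+42864598377971333278717889879957856n^{21}+14112774768258334811947224133207200n^{22}+3792767821678824360172514888155200n^{23}+794361837155729632017165183072000n^{24}+116043940188584781261941387520000n^{25}+13060893411204430405451522400000n^{26}+289244236501957180022014400000n^{27}\right),$$ $$B_{18}(n)=\frac{1}{423402405888}\left(-55496200144551936-467758242679076726243328n+5472909833834589001187328n^{2}-4410332948515224336003072n^{3}-2160975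6618656184448330752n^{4}+37468673148478652077517568n^{5}-1626860052707000278242240n^{6}-38762208986859738688258368n^{7}+27607045118286068559257232n^{8}+1107154227820600678095344n^{9}-15507332829722096768002356n^{10}-2366315660287439156433148n^{11}-8623307879627097027873945n^{12}-13735366324249905516963466n^{13}-13757440281650151979546014n^{14}-12900755898121575311143192n^{15}-10340500747400864095666743n^{16}-6930317409924390412742878n^{17}-3925152356494893752400744n^{18}-1854472152659397515017180n^{19}-722798283258424891059927n^{20}-229445043792082570718662n^{21}-57477067090477796948454n^{22}-10881858900604709551120n^{23}-1468476017963773660425n^{24}-112546311362013189250n^{25}\right).$$ $$A_{19}(n)=\frac{1}{321118098301805579775}\left(-84179182761228521904537600+7366438548479078910706241676902400n-116959298654453941092657695632588800n^{2}-170972326237919410662336343329177600n^{3}+759524570206117175472910048204259328n^{4}+318280471471498221766420926959468544n^{5}-1933058883854745091965411887089778688n^{6}+579749257340326311269597538040356864n^{7}+1763462896963552927737980569113348096n^{8}-1352041995877026309865812288201610240n^{9}-412143592566188980635558973141869056n^{10}+691755676477998254159613481918326528n^{11}-248790971320915405292826396234479616n^{12}-299625784792663987805422384839032064n^{13}-146139468330634860038474762798305344n^{14}-261386425368084335788894580678017248n^{15}-288847777126743967716765057473411868n^{16}-250512523334800455382652479791917478n^{17}-197370488281563786269133071413898067n^{18}-133664345576486436861258519720400644n^{19}-77238705351796415763266186254063740n^{20}-38151901412949320804727138419987712n^{21}-15889917923232261303000157908801120n^{22}-5525003978538459953333259098928000n^{23}-1582603813273609168788039287894400n^{24}-361468199731815727659740230464000n^{25}-63067540627174115348978502240000n^{26}-7955227259231198268910444160000n^{27}-578488473003914360044028800000n^{28}\right),$$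 $$B_{19}(n)=\frac{1}{62574418722816}\left(16403508421673877504+1557096947968613264991977472n-52959906698166695672437800960n^{2}+155574920082937160091381792768n^{3}-126360731196644887910843965440n^{4}-72727362895609884398375282688n^{5}+180431747147703186670402183680n^{6}-107363961769992705003824297856n^{7}+19908932545972216148413302720n^{8}+11236616692301367368006321888n^{9}-16791483079071942999534670608n^{10}+20841989723099850932233380072n^{11}+3428175085963041181938667380n^{12}+6603949782443934179733770946n^{13}+15681897587584695354578169939n^{14}+14003715260944451508366103815n^{15}+12254319637885438781323061250n^{16}+10167600945590367457243643604n^{17}+6849103831070179785946677981n^{18}+3847453761207006330088607613n^{19}+1869649487878526939041760160n^{20}+767650692238878738194523762n^{21}+252804446806240143604727613n^{22}+68147519449023564505341633n^{23}+15164698067112102881670090n^{24}+2126091759742705947636600n^{25}+282479533120659193423875n^{26}+6213057256272933701875n^{27}\right).$$ $$A_{20}(n)=\frac{1}{10671075524667301221503025}\left(5594716844676770022819377971200-9250750643380602945818858328041717760n+313743058580721253384873630636008293007360n^{2}-294068455421836449794161167078315201921024n^{3}-1292207528376953868425397814816544731004928n^{4}+1940823034969407782621966520981386904207360n^{5}+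437804752134679853782017671285203993264128n^{6}-2116880826345545687955444120605871562063872n^{7}+990721076408411140554015128189939966398464n^{8}+272850367975467858436778869579041457102848n^{9}-371669077994016465999518841138936537032704n^{10}+229868815709257118145173737636750496348160n^{11}-120455812280669239242639628255394739547904n^{12}+22917626978796429693983390418130034537472n^{13}+106285564865861920034325365027437134203904n^{14}+22544761048910072374171371736713627635712n^{15}+53337230284615159662242961648215439975528n^{16}+71079596167031221225656507856894242565776n^{17}+55568002074232743608475306744184683827652n^{18}+42254997611586820904399619392350619939424n^{19}+29697927832105935635164805834604098345505n^{20}+17359188238254231228911004054650870034120n^{21}+8576528292742475296973733758838435568380n^{22}+3700837550215365838675403755629511059840n^{23}+1362588767785945472213111786677543182240n^{24}+405673698721162185422525950194462130944n^{25}+100320700490407932409280886522755299200n^{26}+20615901047620955183319192406960896000n^{27}+2686554421555249232436652477015840000n^{28}+341655875582146123621423017688320000n^{29}+7136522224285906391839900561280000n^{30}\right),$$ $$B_{20}(n)=\frac{1}{15643604680704}\left(-8201754210836938752-5689560005220521633655029760n+232288515617603501579812208640n^{2}-318578976666945369459861258240n^{3}-835065310912810156426077388800n^{4}+1933017496946702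996647511715840n^{5}-496953280258486157558710103040n^{6}-1753684106467538140415397072000n^{7}+1659053437070581739410571275200n^{8}-81493954049312899192050890080n^{9}-609418823028368887997881939664n^{10}+282450733166594946765113560440n^{11}+27932836473969637365554642100n^{12}-80065670842367584731667637730n^{13}-5122025022248994885833846115n^{14}-17902750990013796663865397409n^{15}-26208008154303031070349213720n^{16}-21081854759995501447253339880n^{17}-16563477500389902366550048185n^{18}-11272851399665663133539145075n^{19}-6470817249501906186767091210n^{20}-3211253979401521184673300330n^{21}-1345845090935851434367696725n^{22}-469527925623881683217058855n^{23}-136382970355528317394158900n^{24}-31890942125732909954767500n^{25}-5673744561573996832929375n^{26}-748993668791069699988125n^{27}-62130572562729337018750n^{28}\right).$$ -/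

import Mathlib

/-- The height (ordinate) of the path `p` after its first `i` steps, where the path starts at the
origin, `U` is the step `(x, y) → (x + 1, y + 1)` and `D` is the step `(x, y) → (x + 1, y - 1)`. -/
def DyckWord.height (p : DyckWord) (i : ℕ) : ℤ :=
  ((p.toList.take i).count DyckStep.U : ℤ) - ((p.toList.take i).count DyckStep.D : ℤ)

/-- The area under the path `p`, that is, between the polygonal line through the points
`(i, p.height i)` and the `x`-axis: the sum of the areas of the trapezoids over `[i, i + 1]`. -/
def DyckWord.area (p : DyckWord) : ℚ :=
  ∑ i ∈ Finset.range p.toList.length, ((p.height i : ℚ) + (p.height (i + 1) : ℚ)) / 2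

/-- `C_r(n)`: the sum of the `r`-th powers of the areas under the Dyck paths from `(0, 0)` to
`(2n, 0)`. -/
def dyckAreaPowerSum (r n : ℕ) : ℚ :=
  ∑ p : {p : DyckWord // p.semilength = n}, p.1.area ^ r

/-- The polynomial `(a₀ + a₁ X + a₂ X² + ⋯) / d` with coefficient list `a = [a₀, a₁, a₂, …]`. -/
noncomputable def polyOfCoeffs (d : ℕ) (a : List ℤ) : Polynomial ℚ :=
  Polynomial.C (1 / (d : ℚ)) *
    ∑ i ∈ Finset.range a.length, Polynomial.C ((a.getD i 0 : ℤ) : ℚ) * Polynomial.X ^ i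

/-- The polynomial multiplying the Catalan number in the formula for `C_r(n)`, `6 ≤ r ≤ 20`. -/
noncomputable def catalanPart : ℕ → Polynomial ℚ
  | 6 => polyOfCoeffs 9009
      [288288, 3698016, 20486408, 63848584, 122396774, 148077150, 111243827, 48686358, 10566420,
      662600]
  | 7 => polyOfCoeffs 1287
      [-82368, -1226976, -8085520, -30889256, -75530124, -123162974, -135119263, -98013596,
      -44831520, -11682480, -1325200]
  | 8 => polyOfCoeffs 43648605
      [5587021440, 94556625408, 722788288128, 3265799067264, 9701608535408, 19903358469408,
      28764103449400, 29324034918864, 20768263159773, 9860607159936, 2923550216056, 458013285120,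
      20512504400]
  | 9 => polyOfCoeffs 4849845
      [-1241560320, -23443002240, -204182347520, -1065215849152, -3719093291680, -9189780277040,
      -16492646171840, -21700974482496, -20913198712605, -14575599095610, -7139684341240,
      -2331148282352, -457134722640, -41025008800]
  | 10 => polyOfCoeffs 602350749
      [308403583488, 6280999801344, 63014063172480, 370990151667072, 1484820531717312,
      4294799054844416, 9205357923232080, 14850760547283152, 18142055023934610, 16738899781156694,
      11534090152821711, 5800502332696150, 2046998896267656, 472906579045360, 60649909311600,
      2154855196000]
  | 11 => polyOfCoeffs 54759159
      [-56073378816, -1145012405760, -13882990701312, -92003735018880, -410529795504384,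
      -1358432365849088, -3395801783146144, -6484715304645680, -9595471281765580,
      -11047438656242198, -9845829544341667, -6726314202129508, -3463016884902932,
      -1303620856874560, -340289273520080, -55517259246400, -4309710392000]
  | 12 => polyOfCoeffs 13537833083775
      [27725482155571200, 95193717781155840, 9640876052796318720, 61450013774372484096,
      289086406694102382720, 1104241858081090362880, 3144421515886030314240,
      6932089344157398591232, 12061727025258786041160, 16643625465714947690320,
      18238950580970659970100, 15800883906134615077328, 10734575570626139091855,
      5643887109431526653720, 2240482393385585306460, 644652391876146430784,
      125916851551649674320, 14333661659980348800, 430012177787208000]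
  | 13 => polyOfCoeffs 1041371775675
      [-4265458793164800, 349388179496294400, -2211717031982069760, -16196159106169122816,
      -58209009049338684672, -253520698389934993280, -864801391384883429120,
      -2129265703409173570112, -4227235758204051731344, -6843287178206651226680,
      -8902135641538852806280, -9344457320793614331928, -7915939733110232713071,
      -5362839595972274356150, -2869539492494760835340, -1191030459860775140344,
      -372243348607709140688, -83262451078458193440, -12049845071152705600, -860024355574416000]
  | 14 => polyOfCoeffs 500899824099675
      [4103371359024537600, -5075047339918049894400, 23141318124490490787840,
      34494577296400314169344, -14872828017438773715456, 410953567687400194534912,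
      1440414190806104219450240, 3760009225493072325497728, 8581741093248566402135328,
      15801218257278458697597344, 23871155147948992437495240, 29518081121808798045098312,
      29921040354613511920214762, 24888016214280216741338426, 16826443607846042331268065,
      9143873900308913242964466, 3946467271477571595810516, 1321621683454257186307368,
      328789003785047624590640, 57099159940714654197600, 6131209772718436056000,
      161812267752532720000]
  | 15 => polyOfCoeffs 100179964819935
      [-1641348543609815040, 12577033819127718420480, -40372464466964520161280,
      -157497172733276438611968, 225209835690737015036928, 152813902056741785650688,
      -1628499099871749902572800, -2782979867963563434004096, -5946011269947035880772544,
      -14302692533444240386031584, -24264896882385005958209840, -33907419060322795016056664,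
      -40452325721007292236628796, -39944708661097493843633966, -32610905619001405526486335,
      -22008706972081802280212252, -12157917775646526445315048, -5425914429192623312260848,
      -1920858163466094794542720, -524001421309111216123200, -105086586510275147376000,
      -14107079397815745120000, -970873606515196320000]
  | 16 => polyOfCoeffs 2649259169663181075
      [86810924471523117465600, -9682231805963656089002311680, 67714215546238089643462164480,
      21103993912454048703938494464, -297166474925292939948955754496,
      209342372431464612771781951488, 301816479572794020172473102336,
      -10656712609757525071153459200, 678907880130924205274796275968,
      1527008735036946176381558516736, 2953562335170384260122489146112,
      4767875485123843955021282439936, 6340883183606060580917498998432,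
      7311577399093565409969337362624, 7049522455630951503397270218448,
      5660754567015025235116157962272, 3819952064878074341292082207891,
      2143455217851430166206337762112, 983682026784128791681580851984,
      365276345008049034472104584448, 107934041369584963322883596320,
      24195544475714653387660876800, 3843396155784968176175008000, 410796040388709866918400000,
      9820845252824331712480000]
  | 17 => polyOfCoeffs 155838774686069475
      [-10213049937826249113600, 7984963123982696241849139200, -49353274485740999588800757760,
      -119759472225996956501352431616, 321177716546971001520812064768,
      273866689280312630345479225344, -870259906258157783831301353472,
      20160055271152763685581574144, 708621587943810428262573137408,
      -813369316824028357154143054592, -996471340317246215623516793344,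
      -1041659308531026352420188957056, -2064719769455086528722330292672,
      -2712797280642604768543807249568, -2906251778946914691503482401856,
      -2749309584485760688394668523456, -2200484813782335885689714692627,
      -1481689251188763804778343539814, -839471019881481237405908449168,
      -396125736630137255987530070816, -153817240235786688531342840352,
      -48290645871626191702327622720, -11900029631907242170381676800,
      -2205033174258316921110848000, -283684872178630909658080000, -19641690505648663424960000]
  | 18 => polyOfCoeffs 6101243867734306015725
      [799702236231670958093107200, -9163967842800901678905699110092800,
      139729196894846508070012337591255040, -42727235495950379752386584289509376,
      -600197462369109446501597929165946880, 616046105653656514621149369219366912,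
      367424838941846273782210916827250688, -720794662932878471542527652702273536,
      221072324222610744062152871946095616, 137987857320331701477688508864416768,
      62095117481100113488288290773273856, 317059022837786069128020167927103744,
      314645060919929652233649820305167232, 582377001804377380762613574254448384,
      761303666740233605976156890876808864, 765069204055520784859471185833253024,
      713355644605058692132500222298269258, 572551515491857269198998163166638630,
      383241781545552193052996567002398927, 218658579320594482612658912724063894,
      106246752315979953905569260977105424, 42864598377971333278717889879957856,
      14112774768258334811947224133207200, 3792767821678824360172514888155200,
      794361837155729632017165183072000, 116043940188584781261941387520000,
      13060893411204430405451522400000, 289244236501957180022014400000]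
  | 19 => polyOfCoeffs 321118098301805579775
      [-84179182761228521904537600, 7366438548479078910706241676902400,
      -116959298654453941092657695632588800, -170972326237919410662336343329177600,
      759524570206117175472910048204259328, 318280471471498221766420926959468544,
      -1933058883854745091965411887089778688, 579749257340326311269597538040356864,
      1763462896963552927737980569113348096, -1352041995877026309865812288201610240,
      -412143592566188980635558973141869056, 691755676477998254159613481918326528,
      -248790971320915405292826396234479616, -299625784792663987805422384839032064,
      -146139468330634860038474762798305344, -261386425368084335788894580678017248,
      -288847777126743967716765057473411868, -250512523334800455382652479791917478,
      -197370488281563786269133071413898067, -133664345576486436861258519720400644,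
      -77238705351796415763266186254063740, -38151901412949320804727138419987712,
      -15889917923232261303000157908801120, -5525003978538459953333259098928000,
      -1582603813273609168788039287894400, -361468199731815727659740230464000,
      -63067540627174115348978502240000, -7955227259231198268910444160000,
      -578488473003914360044028800000]
  | 20 => polyOfCoeffs 10671075524667301221503025
      [5594716844676770022819377971200, -9250750643380602945818858328041717760,
      313743058580721253384873630636008293007360, -294068455421836449794161167078315201921024,
      -1292207528376953868425397814816544731004928, 1940823034969407782621966520981386904207360,
      437804752134679853782017671285203993264128, -2116880826345545687955444120605871562063872,
      990721076408411140554015128189939966398464, 272850367975467858436778869579041457102848,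
      -371669077994016465999518841138936537032704, 229868815709257118145173737636750496348160,
      -120455812280669239242639628255394739547904, 22917626978796429693983390418130034537472,
      106285564865861920034325365027437134203904, 22544761048910072374171371736713627635712,
      53337230284615159662242961648215439975528, 71079596167031221225656507856894242565776,
      55568002074232743608475306744184683827652, 42254997611586820904399619392350619939424,
      29697927832105935635164805834604098345505, 17359188238254231228911004054650870034120,
      8576528292742475296973733758838435568380, 3700837550215365838675403755629511059840,
      1362588767785945472213111786677543182240, 405673698721162185422525950194462130944,
      100320700490407932409280886522755299200, 20615901047620955183319192406960896000,
      2686554421555249232436652477015840000, 341655875582146123621423017688320000,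
      7136522224285906391839900561280000]
  | _ => 0

/-- The polynomial multiplying `4 ^ n` in the formula for `C_r(n)`, `6 ≤ r ≤ 20`. -/
noncomputable def fourPowPart : ℕ → Polynomial ℚ
  | 6 => polyOfCoeffs 16
      [-512, -5352, -23250, -54175, -72405, -54747, -21465, -3390]
  | 7 => polyOfCoeffs 192
      [12288, 154032, 829860, 2519120, 4692765, 5501496, 3992625, 1687605, 355590, 19675]
  | 8 => polyOfCoeffs 24
      [-3072, -44880, -288012, -1075796, -2571265, -4087230, -4368357, -3088143, -1377120,
      -351175, -39350]
  | 9 => polyOfCoeffs 22528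
      [5767168, 96601344, 712490400, 3170882616, 9228947948, 18535990506, 26217829231,
      26166551598, 18159348207, 8457627750, 2477024869, 390552906, 16145585]
  | 10 => polyOfCoeffs 11264
      [-5767168, -110168320, -903428640, -4661575000, -16070004940, -38873622986, -68498378575,
      -88587665980, -83832753015, -57462736980, -27782166005, -9005360740, -1770064985,
      -161455850]
  | 11 => polyOfCoeffs 2236416
      [2290089984, 54881046528, 412604743680, 2642753179200, 10303217178800, 29244104760416,
      61717377161440, 98011589235560, 117940040809305, 107142008597195, 72868944313165,
      36318883656055, 12746488138475, 2955004071985, 392249111775, 13209845125]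
  | 12 => polyOfCoeffs 186368
      [-381681664, -14453913600, -68927132928, -575473561600, -2720720651280, -8466452663760,
      -20947581716152, -39698991916584, -57753673808545, -65588531893885, -57781616913163,
      -39057457298769, -19955612720225, -7494403610295, -1968378805025, -327548633475,
      -26419690250]
  | 13 => polyOfCoeffs 70189056
      [287494373376, 51433490497536, -174357174583296, 952208580649728, 2855378788965888,
      10319242395383184, 29926311891973856, 64856014228662384, 111796511026336188,
      151944434030529855, 164615470854915795, 141353975830344108, 95133381714301892,
      49707895143900210, 19747904412601290, 5712792077422860, 1129232668647912, 136456885619415,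
      3947823419675]
  | 14 => polyOfCoeffs 5013504
      [-41070624768, -36522447224832, 153420116410368, -85192539937536, -1320043713649152,
      -1579883834781072, -7160752101380096, -19588499456466736, -36275914860061500,
      -58254108474395223, -75480015551145777, -78266911941012210, -65689095338586044,
      -44219379534285850, -23566464408081870, -9780679504318848, -3073829749644864,
      -698057164235559, -104393856706505, -7895646839350]
  | 15 => polyOfCoeffs 561512448
      [9199819948032, 105279470570373120, -805117194337075200, 1533937767823918080,
      -332026355862620160, -315193220451079488, 3942980637812321280, 7295498029698984560,
      17824986284751723840, 31453100119701153940, 47094273435281326800, 58291737399457299465,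
      58280189713868216640, 48038882295378751175, 32392328912022226560, 17544681573165902410,
      7557834464649131040, 2551842853993223490, 644739181103490480, 113289660518686925,
      13264686690108000, 341769247961875]
  | 16 => polyOfCoeffs 35094528
      [-1149977493504, -86184070096158720, 580137148355788800, -188406200219120640,
      -2481067722947051520, 3161443365715521600, 40502667725838976, -5521627246233726320,
      -2115070984319476960, -8220530318472988100, -15996818593246732424, -20858639241365992521,
      -24670928658238741970, -24344604192012549095, -19722426122704661230, -13244050115162988362,
      -7299917076752700980, -3261132907258501170, -1161520677781685060, -320459956025754125,
      -65581066387262650, -9184893708033875, -683538495923750]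
  | 17 => polyOfCoeffs 7621243305984
      [499465801300967424, 569244209678459116978176, -6914984044954892885655552,
      16108163926984485542817792, -9233560632771123498169344, -10059255840703245951861504,
      16202442827688669170063808, -6513227519568524324282944, 5920367169414625701643760,
      7422775029828482245133872, 13204749896894678690706644, 26392616595363577570580052,
      31910162004767184668965361, 36159243852541455699302312, 35444376213648310358746190,
      28199836215730241287912060, 18832078314054778439637311, 10589921997964820177089632,
      4881287309469930891003560, 1811591725692440798695820, 541542258140728361385407,
      125072812048058106346312, 19828926602965968877910, 2388415440692982252900,
      56273155681006594625]
  | 18 => polyOfCoeffs 423402405888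
      [-55496200144551936, -467758242679076726243328, 5472909833834589001187328,
      -4410332948515224336003072, -21609756618656184448330752, 37468673148478652077517568,
      -1626860052707000278242240, -38762208986859738688258368, 27607045118286068559257232,
      1107154227820600678095344, -15507332829722096768002356, -2366315660287439156433148,
      -8623307879627097027873945, -13735366324249905516963466, -13757440281650151979546014,
      -12900755898121575311143192, -10340500747400864095666743, -6930317409924390412742878,
      -3925152356494893752400744, -1854472152659397515017180, -722798283258424891059927,
      -229445043792082570718662, -57477067090477796948454, -10881858900604709551120,
      -1468476017963773660425, -112546311362013189250]
  | 19 => polyOfCoeffs 62574418722816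
      [16403508421673877504, 1557096947968613264991977472, -52959906698166695672437800960,
      155574920082937160091381792768, -126360731196644887910843965440,
      -72727362895609884398375282688, 180431747147703186670402183680,
      -107363961769992705003824297856, 19908932545972216148413302720,
      11236616692301367368006321888, -16791483079071942999534670608,
      20841989723099850932233380072, 3428175085963041181938667380, 6603949782443934179733770946,
      15681897587584695354578169939, 14003715260944451508366103815, 12254319637885438781323061250,
      10167600945590367457243643604, 6849103831070179785946677981, 3847453761207006330088607613,
      1869649487878526939041760160, 767650692238878738194523762, 252804446806240143604727613,
      68147519449023564505341633, 15164698067112102881670090, 2126091759742705947636600,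
      282479533120659193423875, 6213057256272933701875]
  | 20 => polyOfCoeffs 15643604680704
      [-8201754210836938752, -5689560005220521633655029760, 232288515617603501579812208640,
      -318578976666945369459861258240, -835065310912810156426077388800,
      1933017496946702996647511715840, -496953280258486157558710103040,
      -1753684106467538140415397072000, 1659053437070581739410571275200,
      -81493954049312899192050890080, -609418823028368887997881939664,
      282450733166594946765113560440, 27932836473969637365554642100,
      -80065670842367584731667637730, -5122025022248994885833846115,
      -17902750990013796663865397409, -26208008154303031070349213720,
      -21081854759995501447253339880, -16563477500389902366550048185,
      -11272851399665663133539145075, -6470817249501906186767091210,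
      -3211253979401521184673300330, -1345845090935851434367696725, -469527925623881683217058855,
      -136382970355528317394158900, -31890942125732909954767500, -5673744561573996832929375,
      -748993668791069699988125, -62130572562729337018750]
  | _ => 0

/-!
Let `C = ∑ catalan n Xⁿ` and `u = (1 - 4X)^(-1/2) = (1 - 2XC)⁻¹`, and let `Φ_r` be the generating
function of the `r`-th moments of the doubled area, `∑ n, 2 ^ r * dyckAreaPowerSum r n * Xⁿ`.

A nonempty Dyck path is uniquely `p.nest + q`, and its doubled area is that of `p`, plus
`4 * p.semilength + 2`, plus that of `q`. Expanding the `r`-th power turns this into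
`Φ_r = [r = 0] + X ∑ k ≤ r, (r choose k) (∑ l ≤ k, (k choose l) E ^ (k - l) Φ_l) Φ_{r - k}`, where
`E = 4X d/dX + 2` multiplies the coefficient of `Xⁿ` by `4n + 2` (`doubledMoment_succ`). Since the
coefficient of `X ^ (n + 1)` on the left depends only on earlier coefficients on the right, the
recursion for `r ≤ R` has only one solution (`CatForm.coeff_toSeries_eq_doubledMoment`).

The solution has the form `Φ_r = 2 ^ r C + p_r(u)` with polynomials `p_r` over `ℤ`. The space of
series `c C + p(u)` is stable under `2X d/dX`, because `2X d/dX u = u³ - u` and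
`2X d/dX C = 2u - 2C`. Products stay computable after multiplication by `4u²X`, because
`XC² = C - 1`, `2uXC = u - 1` and `4u²X = u² - 1`. So the recursion for given polynomials `p_r` is
an identity between integer polynomials, which is evaluated for `r ≤ 20`
(`momentForm_satisfiesRecursion`).

Finally `u² = ∑ 4ⁿ Xⁿ`, and multiplying the `n`-th coefficient by a polynomial in `n` is a polynomial
in `2X d/dX`; therefore a closed form `A(n) * catalan n + B(n) * 4 ^ n` can be compared with
`2 ^ r C + p_r(u)` by the same arithmetic (`dyckAreaPowerSum_eq_of_isClosedForm`).
-/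

/-! ### Areas of concatenated and nested paths -/

namespace DyckWord

lemma height_zero_right (p : DyckWord) : p.height 0 = 0 := by simp [height]

lemma height_length (p : DyckWord) : p.height p.toList.length = 0 := by
  simp [height, p.count_U_eq_count_D]

lemma height_add_of_le (p q : DyckWord) {i : ℕ} (hi : i ≤ p.toList.length) :
    (p + q).height i = p.height i := by
  have h : (p + q).toList = p.toList ++ q.toList := rfl
  simp [height, h, List.take_append_of_le_length hi]

lemma height_add_length_add (p q : DyckWord) (i : ℕ) :
    (p + q).height (p.toList.length + i) = q.height i := by
  have h : (p + q).toList = p.toList ++ q.toList := rfl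
  simp [height, h, List.take_append, List.take_of_length_le, p.count_U_eq_count_D]

lemma area_add (p q : DyckWord) : (p + q).area = p.area + q.area := by
  have h : (p + q).toList = p.toList ++ q.toList := rfl
  unfold area
  rw [h, List.length_append, Finset.sum_range_add]
  congr 1
  · refine Finset.sum_congr rfl fun i hi => ?_
    have hi := Finset.mem_range.1 hi
    rw [height_add_of_le p q hi.le, height_add_of_le p q hi]
  · refine Finset.sum_congr rfl fun i _ => ?_
    rw [height_add_length_add, add_assoc, height_add_length_add]

lemma height_nest_succ (p : DyckWord) {i : ℕ} (hi : i ≤ p.toList.length) :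
    p.nest.height (i + 1) = p.height i + 1 := by
  have h : p.nest.toList = DyckStep.U :: (p.toList ++ [DyckStep.D]) := rfl
  simp only [height, h, List.take_succ_cons, List.take_append_of_le_length hi]
  simp
  ring

lemma area_nest (p : DyckWord) : p.nest.area = p.area + (2 * p.semilength + 1) := by
  have hl : p.nest.toList.length = p.toList.length + 1 + 1 := by
    simp [nest]
  have hz : p.nest.height (p.toList.length + 1 + 1) = 0 := hl ▸ p.nest.height_length
  have hs : ((p.toList.length : ℕ) : ℚ) = 2 * p.semilength := by
    rw [← p.two_mul_semilength_eq_length]; push_cast; ring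
  unfold area
  rw [hl, Finset.sum_range_succ, Finset.sum_range_succ', hz,
    height_nest_succ p le_rfl, height_length, height_zero_right,
    height_nest_succ p (Nat.zero_le _), height_zero_right]
  have : ∀ i ∈ Finset.range p.toList.length,
      ((p.nest.height (i + 1) : ℚ) + (p.nest.height (i + 1 + 1) : ℚ)) / 2 =
        ((p.height i : ℚ) + (p.height (i + 1) : ℚ)) / 2 + 1 := fun i hi => by
    have hi := Finset.mem_range.1 hi
    rw [height_nest_succ p hi.le, height_nest_succ p hi]
    push_cast
    ring
  rw [Finset.sum_congr rfl this, Finset.sum_add_distrib]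
  simp [hs]
  ring

lemma area_zero : (0 : DyckWord).area = 0 := by
  have h : (0 : DyckWord).toList = [] := rfl
  simp [area, h]

end DyckWord

/-! ### The recursion for the moments -/

open BinaryTree in
lemma sum_dyckWord_eq_sum_trees (n : ℕ) (f : DyckWord → ℚ) :
    ∑ p : {p : DyckWord // p.semilength = n}, f p.1 =
      ∑ t ∈ treesOfNumNodesEq n, f (DyckWord.ofTree t) := by
  rw [← Finset.sum_coe_sort (treesOfNumNodesEq n)]
  refine Fintype.sum_equiv (DyckWord.equivTreesOfNumNodesEq n) _ _ fun p => ?_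
  simp [DyckWord.ofTree_toTree]

/-- First-return decomposition: a path of semilength `n + 1` is uniquely `p.nest + q` with the
semilengths of `p` and `q` adding up to `n`. -/
lemma sum_dyckWord_succ (n : ℕ) (f : DyckWord → ℚ) :
    ∑ p : {p : DyckWord // p.semilength = n + 1}, f p.1 =
      ∑ ij ∈ Finset.HasAntidiagonal.antidiagonal n, ∑ p : {p : DyckWord // p.semilength = ij.1},
        ∑ q : {q : DyckWord // q.semilength = ij.2}, f (p.1.nest + q.1) := by
  rw [sum_dyckWord_eq_sum_trees, BinaryTree.treesOfNumNodesEq_succ, Finset.sum_biUnion]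
  · refine Finset.sum_congr rfl fun ij _ => ?_
    rw [sum_dyckWord_eq_sum_trees ij.1 fun p =>
      ∑ q : {q : DyckWord // q.semilength = ij.2}, f (p.nest + q.1)]
    rw [BinaryTree.pairwiseNode, Finset.sum_map, Finset.sum_product]
    refine Finset.sum_congr rfl fun t _ => ?_
    rw [sum_dyckWord_eq_sum_trees ij.2 fun q => f ((DyckWord.ofTree t).nest + q)]
    rfl
  · simp_rw [Set.PairwiseDisjoint, Set.Pairwise, Finset.disjoint_left]
    aesop

/-- The sum of the `r`-th powers of the doubled areas under the Dyck paths of semilength `n`. -/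
def doubledMoment (r n : ℕ) : ℚ := 2 ^ r * dyckAreaPowerSum r n

lemma doubledMoment_eq_sum (r n : ℕ) :
    doubledMoment r n = ∑ p : {p : DyckWord // p.semilength = n}, (2 * p.1.area) ^ r := by
  simp_rw [doubledMoment, dyckAreaPowerSum, Finset.mul_sum, mul_pow]

lemma doubledMoment_zero_right (r : ℕ) : doubledMoment r 0 = if r = 0 then 1 else 0 := by
  rw [doubledMoment_eq_sum, sum_dyckWord_eq_sum_trees 0 fun p => (2 * p.area) ^ r]
  simp [DyckWord.ofTree, DyckWord.area_zero, zero_pow_eq]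

/-- The moment recursion: the doubled area of `p.nest + q` is that of `p`, plus
`4 * p.semilength + 2`, plus that of `q`; expand both additions by the binomial theorem. -/
lemma doubledMoment_succ (r n : ℕ) :
    doubledMoment r (n + 1) = ∑ ij ∈ Finset.HasAntidiagonal.antidiagonal n,
      ∑ k ∈ Finset.range (r + 1), (r.choose k : ℚ) * ((∑ l ∈ Finset.range (k + 1),
        (k.choose l : ℚ) * (4 * (ij.1 : ℚ) + 2) ^ (k - l) * doubledMoment l ij.1) *
          doubledMoment (r - k) ij.2) := by
  rw [doubledMoment_eq_sum, sum_dyckWord_succ n fun p => (2 * p.area) ^ r]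
  refine Finset.sum_congr rfl fun ij _ => ?_
  have hp : ∀ (p : {p : DyckWord // p.semilength = ij.1})
      (q : {q : DyckWord // q.semilength = ij.2}), (2 * (p.1.nest + q.1).area) ^ r =
      ∑ k ∈ Finset.range (r + 1), (r.choose k : ℚ) * ((∑ l ∈ Finset.range (k + 1),
        (k.choose l : ℚ) * (4 * (ij.1 : ℚ) + 2) ^ (k - l) * (2 * p.1.area) ^ l) *
          (2 * q.1.area) ^ (r - k)) := fun p q => by
    have : 2 * (p.1.nest + q.1).area = (2 * p.1.area + (4 * (ij.1 : ℚ) + 2)) + 2 * q.1.area := by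
      rw [DyckWord.area_add, DyckWord.area_nest, p.2]; ring
    rw [this, add_pow]
    refine Finset.sum_congr rfl fun k _ => ?_
    rw [add_pow, mul_comm]
    congr 2
    refine Finset.sum_congr rfl fun l _ => ?_
    ring
  simp_rw [hp, doubledMoment_eq_sum]
  simp_rw [Finset.sum_comm (s := Finset.univ) (t := Finset.range (r + 1))]
  refine Finset.sum_congr rfl fun k _ => ?_
  simp_rw [← Finset.mul_sum]
  congr 1
  rw [← Finset.sum_mul]
  congr 1
  rw [Finset.sum_comm]
  simp_rw [← Finset.mul_sum]

/-! ### The Catalan series and the inverse square root of `1 - 4X` -/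

/-- The generating function `C` of the Catalan numbers, over `ℚ`. -/
noncomputable def catSeries : PowerSeries ℚ := PowerSeries.mk fun n => (catalan n : ℚ)

/-- The series `u = (1 - 4X)^(-1/2)`, written as `(1 - 2XC)⁻¹`. -/
noncomputable def invSqrtSeries : PowerSeries ℚ := (1 - 2 * PowerSeries.X * catSeries)⁻¹

/-- The derivation `2X d/dX`, which multiplies the coefficient of `X ^ n` by `2n`. -/
noncomputable def eulerDeriv : Derivation ℚ (PowerSeries ℚ) (PowerSeries ℚ) :=
  (2 * PowerSeries.X : PowerSeries ℚ) • PowerSeries.derivative ℚ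

section Series

open PowerSeries

lemma coeff_eulerDeriv (f : PowerSeries ℚ) (n : ℕ) :
    coeff n (eulerDeriv f) = 2 * n * coeff n f := by
  have h : eulerDeriv f = C (2 : ℚ) * (X * derivative ℚ f) := by
    rw [map_ofNat]
    simp [eulerDeriv, mul_assoc]
  rw [h, coeff_C_mul]
  cases n with
  | zero => simp
  | succ n => rw [coeff_succ_X_mul, coeff_derivative]; push_cast; ring

lemma catSeries_eq : catSeries = 1 + X * catSeries ^ 2 := by
  have h := congrArg (PowerSeries.map (Nat.castRingHom ℚ)) catalanSeries_sq_mul_X_add_one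
  have hc : PowerSeries.map (Nat.castRingHom ℚ) catalanSeries = catSeries := by
    ext n; simp [catSeries]
  simp only [map_add, map_mul, map_pow, map_one, hc, map_X] at h
  linear_combination -h

lemma invSqrtSeries_mul : invSqrtSeries * (1 - 2 * X * catSeries) = 1 :=
  PowerSeries.inv_mul_cancel _ (by simp)

lemma invSqrtSeries_ne_zero : invSqrtSeries ≠ 0 := fun h => by
  simpa [h] using invSqrtSeries_mul

lemma two_mul_invSqrt_mul_X_mul_cat :
    2 * invSqrtSeries * X * catSeries = invSqrtSeries - 1 := by
  linear_combination -invSqrtSeries_mul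

lemma four_mul_invSqrt_sq_mul_X :
    4 * invSqrtSeries ^ 2 * X = invSqrtSeries ^ 2 - 1 := by
  linear_combination -(4 * X * invSqrtSeries ^ 2) * catSeries_eq -
    (invSqrtSeries * (1 - 2 * X * catSeries) + 1) * invSqrtSeries_mul

lemma coeff_invSqrtSeries_sq (n : ℕ) : coeff n (invSqrtSeries ^ 2) = 4 ^ n := by
  have h : invSqrtSeries ^ 2 = 1 + C (4 : ℚ) * (X * invSqrtSeries ^ 2) := by
    rw [map_ofNat]
    linear_combination -four_mul_invSqrt_sq_mul_X
  induction n with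
  | zero => rw [h]; simp
  | succ n ih =>
    rw [h, map_add, coeff_C_mul, coeff_succ_X_mul, ih, coeff_one, if_neg n.succ_ne_zero]
    ring

lemma two_ne_zero_powerSeries : (2 : PowerSeries ℚ) ≠ 0 := fun h => by
  simpa [← map_ofNat (C (R := ℚ))] using congrArg (coeff 0) h

lemma eulerDeriv_X : eulerDeriv (X : PowerSeries ℚ) = 2 * X := by simp [eulerDeriv]

lemma eulerDeriv_invSqrtSeries :
    eulerDeriv invSqrtSeries = invSqrtSeries ^ 3 - invSqrtSeries := by
  -- apply the derivation to `u² (1 - 4X) = 1` and use `4u²X = u² - 1` again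
  have h := congrArg eulerDeriv four_mul_invSqrt_sq_mul_X
  have h4 : eulerDeriv (4 : PowerSeries ℚ) = 0 := by
    simpa using eulerDeriv.map_natCast 4
  simp only [Derivation.leibniz, Derivation.leibniz_pow, map_sub, eulerDeriv_X, h4,
    Derivation.map_one_eq_zero, smul_eq_mul, nsmul_eq_mul, Nat.cast_ofNat] at h
  apply mul_left_cancel₀ two_ne_zero_powerSeries
  linear_combination -invSqrtSeries * h +
    (2 * eulerDeriv invSqrtSeries + 2 * invSqrtSeries) * four_mul_invSqrt_sq_mul_X

lemma eulerDeriv_catSeries : eulerDeriv catSeries = 2 * invSqrtSeries - 2 * catSeries := by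
  have h := congrArg eulerDeriv two_mul_invSqrt_mul_X_mul_cat
  have h2 : eulerDeriv (2 : PowerSeries ℚ) = 0 := by
    simpa using eulerDeriv.map_natCast 2
  simp only [Derivation.leibniz, map_sub, eulerDeriv_X, h2, eulerDeriv_invSqrtSeries,
    Derivation.map_one_eq_zero, smul_eq_mul] at h
  have h0 : (2 * invSqrtSeries * X : PowerSeries ℚ) ≠ 0 :=
    mul_ne_zero (mul_ne_zero two_ne_zero_powerSeries invSqrtSeries_ne_zero) X_ne_zero
  apply mul_left_cancel₀ h0
  linear_combination h - (invSqrtSeries ^ 2 - 1) * two_mul_invSqrt_mul_X_mul_cat -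
    four_mul_invSqrt_sq_mul_X

end Series

/-! ### Exact arithmetic with integer combinations of `C` and powers of `u` -/

/-- The sum of two polynomials given by their coefficient lists (constant term first). -/
def listAdd : List ℤ → List ℤ → List ℤ
  | [], q => q
  | a :: p, [] => a :: p
  | a :: p, b :: q => (a + b) :: listAdd p q

/-- The product of two polynomials given by their coefficient lists. -/
def listMul : List ℤ → List ℤ → List ℤ
  | [], _ => []
  | a :: p, q => listAdd (q.map (a * ·)) (0 :: listMul p q)

/-- The coefficient list of `u ^ (-m) * 2X d/dX (u ^ m * p(u))`, where `u = (1 - 4X)^(-1/2)`;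
it comes from `2X d/dX (u ^ m) = m (u ^ (m + 2) - u ^ m)`. -/
def listEuler : ℤ → List ℤ → List ℤ
  | _, [] => []
  | m, a :: p => listAdd [-(m * a), 0, m * a] (0 :: listEuler (m + 1) p)

/-- The pair `⟨c, p⟩` encodes the power series `c * C + p(u)`, where `C` is the Catalan series,
`u = (1 - 4X)^(-1/2)` and `p` is a coefficient list. -/
structure CatForm where
  /-- the coefficient of the Catalan series -/
  cat : ℤ
  /-- the coefficients of the polynomial in `u` -/
  pol : List ℤ

namespace CatForm

def add (f g : CatForm) : CatForm := ⟨f.cat + g.cat, listAdd f.pol g.pol⟩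

def smul (c : ℤ) (f : CatForm) : CatForm := ⟨c * f.cat, f.pol.map (c * ·)⟩

/-- The action of `2X d/dX`, using `2X d/dX C = 2u - 2C`. -/
def euler (f : CatForm) : CatForm := ⟨-(2 * f.cat), listAdd [0, 2 * f.cat] (listEuler 0 f.pol)⟩

/-- The action of `4X d/dX + 2`, which multiplies the coefficient of `X ^ n` by `4n + 2`. -/
def shift (f : CatForm) : CatForm := (f.euler.add f).smul 2

/-- The product of two series, multiplied by `4u²X`. The result `⟨c, p⟩` stands for
`4u²c * C + p(u)`; this uses `XC² = C - 1`, `2uXC = u - 1` and `4u²X = u² - 1`. -/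
def mulX (f g : CatForm) : CatForm :=
  ⟨f.cat * g.cat, listAdd [0, 0, -4 * (f.cat * g.cat)]
    (listAdd (listMul [0, -2, 2] (listAdd (g.pol.map (f.cat * ·)) (f.pol.map (g.cat * ·))))
      (listMul [-1, 0, 1] (listMul f.pol g.pol)))⟩

/-- The power series `p(u)`, for a polynomial `p` given by its coefficient list. -/
noncomputable def polSeries : List ℤ → PowerSeries ℚ
  | [] => 0
  | a :: p => (a : PowerSeries ℚ) + invSqrtSeries * polSeries p

/-- The power series that a pair encodes. -/
noncomputable def toSeries (f : CatForm) : PowerSeries ℚ :=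
  (f.cat : PowerSeries ℚ) * catSeries + polSeries f.pol

lemma polSeries_listAdd (p q : List ℤ) :
    polSeries (listAdd p q) = polSeries p + polSeries q := by
  induction p, q using listAdd.induct with
  | case1 q => simp [listAdd, polSeries]
  | case2 a p => simp [listAdd, polSeries]
  | case3 a p b q ih => simp only [listAdd, polSeries, ih]; push_cast; ring

lemma polSeries_map_mul (c : ℤ) (p : List ℤ) :
    polSeries (p.map (c * ·)) = c * polSeries p := by
  induction p with
  | nil => simp [polSeries]
  | cons a p ih => simp only [List.map_cons, polSeries, ih]; push_cast; ring

lemma polSeries_listMul (p q : List ℤ) :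
    polSeries (listMul p q) = polSeries p * polSeries q := by
  induction p with
  | nil => simp [listMul, polSeries]
  | cons a p ih =>
    simp only [listMul, polSeries, polSeries_listAdd, polSeries_map_mul, ih]
    push_cast; ring

lemma polSeries_listEuler (m : ℤ) (p : List ℤ) :
    polSeries (listEuler m p) =
      eulerDeriv (polSeries p) + m * (invSqrtSeries ^ 2 - 1) * polSeries p := by
  induction p generalizing m with
  | nil => simp [listEuler, polSeries]
  | cons a p ih =>
    simp only [listEuler, polSeries, polSeries_listAdd, ih, map_add, Derivation.leibniz,
      eulerDeriv_invSqrtSeries, Derivation.map_intCast, smul_eq_mul]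
    push_cast; ring

lemma polSeries_eq_zero {p : List ℤ} (h : p.all (· == 0) = true) : polSeries p = 0 := by
  induction p with
  | nil => rfl
  | cons a p ih =>
    simp only [List.all_cons, Bool.and_eq_true, beq_iff_eq] at h
    simp [polSeries, h.1, ih h.2]

lemma toSeries_add (f g : CatForm) : (f.add g).toSeries = f.toSeries + g.toSeries := by
  simp only [toSeries, add, polSeries_listAdd]; push_cast; ring

lemma toSeries_smul (c : ℤ) (f : CatForm) : (f.smul c).toSeries = c * f.toSeries := by
  simp only [toSeries, smul, polSeries_map_mul]; push_cast; ring

lemma toSeries_euler (f : CatForm) : f.euler.toSeries = eulerDeriv f.toSeries := by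
  simp only [toSeries, euler, polSeries_listAdd, polSeries_listEuler, polSeries, map_add,
    Derivation.leibniz, eulerDeriv_catSeries, Derivation.map_intCast, smul_eq_mul]
  push_cast; ring

lemma coeff_toSeries_shift (f : CatForm) (n : ℕ) :
    PowerSeries.coeff n f.shift.toSeries = (4 * n + 2) * PowerSeries.coeff n f.toSeries := by
  have : f.shift.toSeries = PowerSeries.C (2 : ℚ) * (eulerDeriv f.toSeries + f.toSeries) := by
    rw [shift, toSeries_smul, toSeries_add, toSeries_euler, map_ofNat]; push_cast; rfl
  rw [this, PowerSeries.coeff_C_mul, map_add, coeff_eulerDeriv]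
  ring

lemma toSeries_mulX (f g : CatForm) :
    4 * invSqrtSeries ^ 2 * PowerSeries.X * (f.toSeries * g.toSeries) =
      4 * invSqrtSeries ^ 2 * ((f.mulX g).cat : PowerSeries ℚ) * catSeries +
        polSeries (f.mulX g).pol := by
  simp only [toSeries, mulX, polSeries_listAdd, polSeries_listMul, polSeries_map_mul, polSeries]
  push_cast
  linear_combination -(4 * invSqrtSeries ^ 2 * (f.cat : PowerSeries ℚ) * g.cat) * catSeries_eq +
    2 * invSqrtSeries * (f.cat * polSeries g.pol + g.cat * polSeries f.pol) *
      two_mul_invSqrt_mul_X_mul_cat +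
    polSeries f.pol * polSeries g.pol * four_mul_invSqrt_sq_mul_X

end CatForm

/-! ### The moment recursion for encoded series -/

/-- `forceNat n k` is `k n`, in a form whose reduction evaluates `n` before passing it on. -/
def forceNat {β : Type} (n : ℕ) (k : ℕ → β) : β :=
  match n with
  | 0 => k 0
  | n + 1 => k (Nat.succ n)

/-- Call by value for integers, see `forceNat`. -/
def forceInt {β : Type} (a : ℤ) (k : ℤ → β) : β :=
  match a with
  | .ofNat n => forceNat n fun n => k (.ofNat n)
  | .negSucc n => forceNat n fun n => k (.negSucc n)

/-- Call by value for lists of integers, see `forceNat`. -/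
def forceList {β : Type} : List ℤ → (List ℤ → β) → β
  | [], k => k []
  | a :: p, k => forceInt a fun a => forceList p fun p => k (a :: p)

lemma forceNat_eq {β : Type} (n : ℕ) (k : ℕ → β) : forceNat n k = k n := by
  cases n <;> rfl

lemma forceInt_eq {β : Type} (a : ℤ) (k : ℤ → β) : forceInt a k = k a := by
  cases a <;> simp [forceInt, forceNat_eq]

lemma forceList_eq {β : Type} (p : List ℤ) (k : List ℤ → β) : forceList p k = k p := by
  induction p generalizing k with
  | nil => rfl
  | cons a p ih => simp [forceList, forceInt_eq, ih]

/-- The binomial coefficient, by a formula whose reduction takes `O(k)` steps. -/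
def fastChoose (n k : ℕ) : ℤ := ((n.descFactorial k / k.factorial : ℕ) : ℤ)

lemma fastChoose_eq (n k : ℕ) : fastChoose n k = (n.choose k : ℤ) := by
  rw [fastChoose, Nat.choose_eq_descFactorial_div_factorial]

namespace CatForm

/-- Call by value for encoded series, see `forceNat`. -/
def force {β : Type} (f : CatForm) (k : CatForm → β) : β :=
  forceInt f.cat fun c => forceList f.pol fun p => k ⟨c, p⟩

lemma force_eq {β : Type} (f : CatForm) (k : CatForm → β) : f.force k = k f := by
  simp [force, forceInt_eq, forceList_eq]

/-- For a sequence `m` of encoded series, `shiftSum m k j` encodes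
`∑ l < j, (k choose l) E ^ (j - 1 - l) (m l)`, where `E = 4X d/dX + 2`; it is computed by
Horner's rule. -/
def shiftSum (m : ℕ → CatForm) (k : ℕ) : ℕ → CatForm
  | 0 => ⟨0, []⟩
  | l + 1 => (shiftSum m k l).force fun s =>
      s.shift.force fun t => t.add ((m l).smul (fastChoose k l))

/-- `convSum m r j` encodes, in the sense of `CatForm.mulX`, the series
`4u²X * ∑ k < j, (r choose k) (∑ l ≤ k, (k choose l) E ^ (k - l) (m l)) (m (r - k))`. -/
def convSum (m : ℕ → CatForm) (r : ℕ) : ℕ → CatForm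
  | 0 => ⟨0, []⟩
  | k + 1 => (convSum m r k).force fun s => (shiftSum m k (k + 1)).force fun g =>
      s.add ((g.mulX (m (r - k))).smul (fastChoose r k))

/-- The test that the encoded series `m 0, …, m r` satisfy the moment recursion at order `r`,
that is, that `4u²(m r - [r = 0])` equals the series encoded by `convSum m r (r + 1)`. -/
def satisfiesRecursion (m : ℕ → CatForm) (r : ℕ) : Bool :=
  (convSum m r (r + 1)).force fun s =>
    s.cat == (m r).cat &&
      (listAdd (listMul [0, 0, -4] (m r).pol)
        (listAdd (if r = 0 then [0, 0, 4] else []) s.pol)).all (· == 0)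

lemma coeff_intCast_mul (c : ℤ) (f : PowerSeries ℚ) (n : ℕ) :
    PowerSeries.coeff n ((c : PowerSeries ℚ) * f) = c * PowerSeries.coeff n f := by
  rw [← map_intCast (PowerSeries.C (R := ℚ)), PowerSeries.coeff_C_mul]

lemma coeff_shiftSum (m : ℕ → CatForm) (k j n : ℕ) :
    PowerSeries.coeff n (shiftSum m k j).toSeries = ∑ l ∈ Finset.range j,
      (k.choose l : ℚ) * (4 * n + 2) ^ (j - 1 - l) * PowerSeries.coeff n (m l).toSeries := by
  induction j with
  | zero => simp [shiftSum, toSeries, polSeries]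
  | succ j ih =>
    rw [shiftSum, force_eq, force_eq, toSeries_add, map_add, coeff_toSeries_shift, ih,
      toSeries_smul, coeff_intCast_mul, fastChoose_eq, Finset.sum_range_succ, Finset.mul_sum]
    congr 1
    · refine Finset.sum_congr rfl fun l hl => ?_
      have hl := Finset.mem_range.1 hl
      have : j + 1 - 1 - l = (j - 1 - l) + 1 := by omega
      rw [this, pow_succ]
      ring
    · simp

lemma toSeries_convSum (m : ℕ → CatForm) (r j : ℕ) :
    4 * invSqrtSeries ^ 2 * ((convSum m r j).cat : PowerSeries ℚ) * catSeries +
        polSeries (convSum m r j).pol =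
      4 * invSqrtSeries ^ 2 * PowerSeries.X * ∑ k ∈ Finset.range j, (r.choose k : PowerSeries ℚ) *
        ((shiftSum m k (k + 1)).toSeries * (m (r - k)).toSeries) := by
  induction j with
  | zero => simp [convSum, polSeries]
  | succ j ih =>
    rw [convSum, force_eq, force_eq, Finset.sum_range_succ, mul_add, ← ih]
    simp only [add, smul, polSeries_listAdd, polSeries_map_mul, fastChoose_eq]
    push_cast
    linear_combination -(r.choose j : PowerSeries ℚ) *
      toSeries_mulX (shiftSum m j (j + 1)) (m (r - j))

lemma toSeries_eq_of_satisfiesRecursion {m : ℕ → CatForm} {r : ℕ}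
    (h : satisfiesRecursion m r = true) :
    (m r).toSeries = (if r = 0 then 1 else 0) + PowerSeries.X * ∑ k ∈ Finset.range (r + 1),
      (r.choose k : PowerSeries ℚ) *
        ((shiftSum m k (k + 1)).toSeries * (m (r - k)).toSeries) := by
  rw [satisfiesRecursion, force_eq, Bool.and_eq_true, beq_iff_eq] at h
  obtain ⟨hc, hp⟩ := h
  have hp := polSeries_eq_zero hp
  have hs := toSeries_convSum m r (r + 1)
  have h0 : (4 * invSqrtSeries ^ 2 : PowerSeries ℚ) ≠ 0 := by
    have : (4 : PowerSeries ℚ) = 2 * 2 := by norm_num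
    rw [this]
    exact mul_ne_zero (mul_ne_zero two_ne_zero_powerSeries two_ne_zero_powerSeries)
      (pow_ne_zero 2 invSqrtSeries_ne_zero)
  apply mul_left_cancel₀ h0
  rw [hc] at hs
  simp only [polSeries_listAdd, polSeries_listMul] at hp
  have hd : polSeries (if r = 0 then [0, 0, 4] else []) =
      4 * invSqrtSeries ^ 2 * (if r = 0 then 1 else 0) := by
    split_ifs
    · simp only [polSeries]; push_cast; ring
    · simp [polSeries]
  rw [hd] at hp
  simp only [polSeries] at hp
  push_cast at hp
  rw [toSeries]
  linear_combination hs - hp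

/-- The moment recursion determines the moments: series that pass the test up to order `R` are the
generating functions of the moments of the doubled area up to that order. -/
theorem coeff_toSeries_eq_doubledMoment {m : ℕ → CatForm} {R : ℕ}
    (h : ∀ r ≤ R, satisfiesRecursion m r = true) (n : ℕ) :
    ∀ r ≤ R, PowerSeries.coeff n (m r).toSeries = doubledMoment r n := by
  induction n using Nat.strong_induction_on with
  | _ n ih =>
    intro r hr
    rw [toSeries_eq_of_satisfiesRecursion (h r hr), map_add]
    cases n with
    | zero =>
      rw [doubledMoment_zero_right]
      split_ifs <;> simp
    | succ n =>
      have h0 : PowerSeries.coeff (n + 1) (if r = 0 then (1 : PowerSeries ℚ) else 0) = 0 := by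
        split_ifs <;> simp [PowerSeries.coeff_one]
      rw [h0, zero_add, PowerSeries.coeff_succ_X_mul, map_sum, doubledMoment_succ,
        Finset.sum_comm]
      refine Finset.sum_congr rfl fun k hk => ?_
      have hk := Finset.mem_range.1 hk
      rw [← Finset.mul_sum, ← Int.cast_natCast, coeff_intCast_mul, Int.cast_natCast,
        PowerSeries.coeff_mul]
      congr 1
      refine Finset.sum_congr rfl fun ij hij => ?_
      have hij := Finset.HasAntidiagonal.mem_antidiagonal.1 hij
      rw [coeff_shiftSum, ih ij.2 (by omega) (r - k) (by omega)]
      congr 1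
      refine Finset.sum_congr rfl fun l hl => ?_
      have hl := Finset.mem_range.1 hl
      rw [ih ij.1 (by omega) l (by omega), Nat.add_sub_cancel]

end CatForm

/-! ### The first twenty moment series -/

/-- The `r`-th entry lists the coefficients of the polynomial `p` for which
`2 ^ r * C + p(u)` is the generating function of the `r`-th moments of the doubled area. -/
def momentPols : List (List ℤ) :=
  [
    [],
    [0, -4, 2],
    [0, -8, 8, 2, -16, 10],
    [0, -16, 20, -24, -108, 300, -60, -300, 180],
    [0, -32, 32, -208, 416, 3178, -8160, -3270, 19104, -6186, -11520, 6630],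
    [0, -64, 32, 0, 10320, -22800, -150480, 375780, 374400, -1347900, 3840, 1723740, -644400,
      -729300, 406800],
    [0, -128, 128, 7952, -16576, -841760, 1861440, 11258850, -27415680, -40914870, 125107200,
      40250100, -242746560, 37715940, 211550400, -84745350, -68342400, 37271250],
    [0, -256, 800, -1344, -1585248, 3316320, 95393760, -209767320, -1222129440, 2915128860,
      5506868640, -15483780060, -9696849120, 39425909880, 2559967200, -51889496400,
      12239186400, 34109239500, -14240620800, -8870557500, 4759776000],
    [0, -512, 512, -717568, 1450496, 333846208, -700439040, -14437392480, 31591816704,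
      180696937554, -424384611840, -937500563790, 2504452446720, 2260855355850,
      -7734598986240, -2151359401590, 13471445675520, -947007471690, -13342584729600,
      3813886087830, 7017905664000, -3013146508050, -1523128320000, 807679860750],
    [0, -1024, -14848, 30720, 416563200, -849684480, -81363425280, 170821708800,
      2823543164160, -6157218160800, -34828023363840, 80870093139780, 199923367795200,
      -516086796351420, -594045075778560, 1843156819676340, 885058976954880,
      -3948691875983820, -363490352547840, 5193496462786380, -798428084428800,
      -4110966434321460, 1315477129881600, 1798588439379900, -788177831212800,
      -334379462350500, 175767296544000],
    [0, -2048, 2048, 103818752, -208347136, -202607982080, 415231610880, 23391954736800,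
      -49130092508160, -693891085290240, 1509797783116800, 8473130196013050,
      -19508910785925120, -52524535993239870, 132324277349376000, 181802038683132000,
      -529745578322688000, -354812619055557600, 1333356287051980800, 332052127626183300,
      -2171077791366758400, 50549824621113300, 2286238299448320000, -480876367412775600,
      -1504363089495168000, 518772291163686000, 562714417609344000, -250491863823468750,
      -91398994202880000, 47726675630156250],
    [0, -4096, 711680, -1419264, -167131481088, 337181475840, 98228440442880,
      -201869035463040, -7938876212213760, 16684067378320320, 209391886195514880,
      -454988799518353320, -2537896526950371840, 5806122337034481660, 16718754951196531200,
      -41363033120142356700, -65127178768001011200, 181655244188165008800,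
      153864838864261324800, -520720160091171994800, -208120047264280166400,
      1003994575545536883000, 104707145073041280000, -1313496963531085548600,
      133418992847817600000, 1151037859456257696000, -289173078810399168000,
      -647320885540577325000, 235464156508198464000, 211295366072016187500,
      -95236080322743360000, -30449619052039687500, 15818842376568000000],
    [0, -8192, 8192, -22163427328, 44371582976, 176948463455488, -358525407313920,
      -50694749981399040, 104389104382869504, 3162183245585943744, -6651238607888117760,
      -76126661794680470160, 165287553107967037440, 917393050060758409050,
      -2088407384041142292480, -6350298860669337562230, 15493146435480631357440,
      27204271203746213233470, -73479217806575478374400, -74401098417977299997490,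
      234595062129902203699200, 127539067579562256502500, -519459745837223387750400,
      -118599312919553171451900, 808317367075038823833600, 4470443176046098412700,
      -881898432029826494976000, 139431798869043705878700, 660970638807197419008000,
      -186483091258163382155550, -324311904653367375360000, 122789459072215844543250,
      93851623863495590400000, -42731521074951752216250, -12148870945204224000000,
      6285904577012850693750],
    [0, -16384, -44720128, 89456640, 95099617966080, -190933968476160, -162485862331054080,
      330230113469867520, 28634468366876037120, -59064055114576512000,
      -1466554650802616094720, 3087917518085137657920, 32819781066734524262400,
      -71229905225638429910640, -393708518433847018321920, 892740690397841210305380,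
      2840000174734889210204160, -6852593590698313530612540, -13161006304370032314286080,
      34683846948376763072595660, 40483258886314826623641600, -121297000921577726263838820,
      -82600825211672186555136000, 301667140267239997507257000, 105112748750724727210598400,
      -541751660053124163847003800, -59868906327723344153702400, 704965545994149011454082200,
      -46508953611095091148032000, -658729571186851208524279800, 132261372749035139081472000,
      430952869246980427586939700, -132000580499508289400832000, -187442519976844622569579500,
      73215261233155106537472000, 48699576468757176279817500, -22360024445540636574720000,
      -5720173165081694131312500, 2949981425885202508800000],
    [0, -32768, 32768, 6534564349952, -13072936247296, -211127872840294400,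
      425260830775173120, 144684495709606944000, -294729323859076055040,
      -17909318191245778402560, 37001465233910102016000, 785335093845367026452400,
      -1655464883360701002670080, -16555538259302012036146080, 35924928644800227813580800,
      197868710167329903438186450, -447239151563648175289958400,
      -1478038704272618132105410950, 3534402570570265783585996800,
      7319005737298196001896335500, -18916624941949784251070668800,
      -24816036660597782970081812100, 71541575987577619849532006400,
      58079159165478184864315935750, -196502989064599992499845120000,
      -91279553332217915541206380050, 398386857352265408499089817600,
      84884405701117246029341335800, -600167135151484824359878041600,
      -14897014571646680037218854200, 670089054240424165571288064000,
      -80439560004504597634400112450, -547065138119298520837699584000,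
      128074836636491994798257258550, 317370283384555144429830144000,
      -103366703985090583503942976500, -123922164682226946771800064000,
      49626506918385228920726137500, 29203591641950370895810560000,
      -13503450397174908172846593750, -3138780237141855469363200000,
      1614362754577178993418281250],
    [0, -65536, 3807580160, -7615094784, -72844943495344128, 145939614711951360,
      355278947554710220800, -717549898972956072960, -131732969377390834913280,
      268860373414693937210880, 12453612793320213885726720, -25770900414535468616249280,
      -481652519501598476011868160, 1016520441291397044458295840,
      9660314020390572294572544000, -20962099771758271448243321400,
      -115106512019721859246863052800, 259485661426119226524069543900,
      886002551811299047916715724800, -2102946522097377956460665103900,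
      -4643976803929181945125214515200, 11815139552788648477055772117000,
      17100510657447396711752123904000, -47833581877499616463660417822800,
      -44793499527861312552683014656000, 143208223262590572662855663884500,
      82562230185000340617183204864000, -322305933513340391608769970694500,
      -100893415441387391590453830144000, 549974396673466248511234265058000,
      62721223596356199347476523520000, -712383417414055114850112937947000,
      28618587569959484720378595840000, 695802852375470685533844731074500,
      -112935769844950401306182184960000, -504063479878888440677155031542500,
      131481033922146002149212917760000, 262580455014597801053857009125000,
      -89698541912458831682867496960000, -92993007100048156843912170000000,
      38008104219397754116580505600000, 20047451035806865051147954687500,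
      -9325557821800821600679680000000, -1985666188129930161904485937500,
      1018984178553266807481600000000],
    [0, -131072, 131072, -2541894145343488, 5084208021241856, 330575621562988576768,
      -663751633836510412800, -530578637953627553587200, 1073925207161117606805504,
      126049239430160428295568384, -257703491688894123522785280,
      -9630468166658218543986516480, 19960363508457497612799836160,
      335767399987826868704925609600, -709480401962957128348157214720,
      -6456326721748286284545330697920, 14010732698805649333888444661760,
      76733299959132592389316604813730, -172595475531761077372869682790400,
      -606233005862263995357452624023710, 1429900097537036171661948606873600,
      3338394537015596946123642105349650, -8383586364837449604662736155443200,
      -13199090882908793694138035198419950, 36036114462347320518686095019212800,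
      38022985400268967262999294814203850, -116367334762793495677004064964608000,
      -79650126017116075119068045634108150, 286919659268797219370878477713408000,
      117725830000164450425320777733765850, -545358844403090128094774655172608000,
      -109906926092493238916279362624083750, 801950563902849133676085797142528000,
      30985942297373834338698364920435750, -910058047589541950326761009315840000,
      82895252093048302360882739427867750, 789446753408151301627588944199680000,
      -154911401199169462871299740984770250, -513783587683227178092297662300160000,
      145268321757586790683501631634333750, 242794612396925657866102136832000000,
      -86162347773573864321040299368831250, -78655278687889888473354657792000000,
      32699057736328359340206542518968750, 15623080197677060858737827840000000,
      -7305113977441928098367543658281250, -1434729723402999664934092800000000,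
      734851891091128817776087286718750],
    [0, -262144, -419730423808, 839461109760, 72272125971258408960, -144654309653147811840,
      -995696170965820216442880, 2003556568932355287613440, 760129967617722944944865280,
      -1541348556561709979320320000, -128630978144760797988637900800,
      263409747061545726242433884160, 8267907321979700039857845043200,
      -17162992484487315011366310696960, -264200003845520949413407292129280,
      558914601050472004302275874501120, 4899798874425535815143948914851840,
      -10634345718433790531718592562852160, -58107808887218322418124773926174720,
      130452636398852611685046531056798340, 469705932596691434147141174752051200,
      -1101950718818868099691927920918995580, -2701146317176332813923302580866252800,
      6709427177725617292481279970751827300, 11363993054280183510238289728477593600,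
      -30414298521743274328359962752115055900, -35530085677532849935352591112024883200,
      105027620947441869183755398540744454100, 82809853060932213242102615632084992000,
      -280701437944811874175196280203060025900, -141710749056330648794347273297035264000,
      586528958865489951089933484137750042100, 168435980531652931004420930014101504000,
      -963017401154328359624294173046442559500, -111950738291521963469330382304641024000,
      1242655581914702524313977783534875391500, -25597002041125324566597664508805120000,
      -1253761795292971138794104969876148256500, 165506542606723036011767245619527680000,
      977714682228830241985841754942971731500, -219036504445643979891999401874554880000,
      -577437574566074879651844702744323932500, 173811336949687631464488500880998400000,
      249643569040251988756051364305876537500, -91398846038486229082620551217807360000,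
      -74511042805224296072406354432245062500, 31424612755452676647348617610854400000,
      13719593847334735251922234365098437500, -6443958573977566042605349297152000000,
      -1174293321963623850806187484176562500, 600469620450691411157445227520000000],
    [0, -524288, 524288, 1260878644162199552, -2521815466095149056, -658181352314405537054720,
      1319248108450770227036160, 2441963977938156267422515200, -4922990121496848924876472320,
      -1090081938578086531066922926080, 2213970356296424699334151372800,
      141097584755535006020042280806400, -289393575037245630903357737533440,
      -7859025750542722645469854303549440, 16339089758217431030809161419980800,
      233151654603507593308250428686024000, -493794647835384324673428080040345600,
      -4190539576525895876899007061831340800, 9096513941154808634403005302800384000,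
      49604132165169188072718224930221295850, -111178432720969330951331849550377779200,
      -409170355933728023236652756326315735950, 955489226551662671101377834904269619200,
      2445122537737613218441394258032442575800, -6017066025518144679032051385738854400000,
      -10866748126825719515147719438555462787400, 28603487275080292336739161745880435916800,
      36496761932315684974338591087699897458400, -104878888454356775961772218511311293644800,
      -93193857816167441224978230107059890393600, 301197784649457659553904620813094748160000,
      179705465371752193903411833851517038321400, -684532049687030695408802317780188069888000,
      -253894008035598885639099371392646200590600,
      1238557821217230549067742403534134181888000, 238494853554848810585466013072257128230500,
      -1787539111755365631397920487448923865088000,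
      -87658945986592059266980512946128598195500, 2053187215790451276327213893757578772480000,
      -140245668637998323967418052759918046687000,
      -1863710965445346003806441266057586933760000,
      308606454922218498995897261794317334497000, 1319546077266176721123437760641795358720000,
      -326217480991114299069846686050348270650000,
      -713163812754668555665242847161601228800000, 225688026741326559600394541913661135050000,
      284090264097534374622804972315314749440000, -106748249089813942839136190862209004375000,
      -78599725605715039863668876550043238400000, 33559566523477944486216618531408440625000,
      13486885183851973661054963543003136000000, -6359655784895206504156597997513636718750,
      -1080845316811244540083401409536000000000, 551894216034859906012511593922191406250],
    [0, -1048576, 58177771274240, -116355541499904, -90157042041065687482368,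
      180375092672688264314880, 3486681437344388658942443520, -7000129422909737357182894080,
      -5403444367567292709028724736000, 10910959303825932979531088855040,
      1604020193941236024440692510556160, -3262666643671977989351824633405440,
      -167021762301784144862432854427566080, 343091001058339546905066080169553920,
      8244977357389379719476701498808729600, -17166907983052772957697724663039584000,
      -229413636435244911026711961486517862400, 486410665542687330682197877290548092800,
      4011745537842911591834810180072108851200, -8710032674587619897131000684705150825800,
      -47411202727619046899472809009573373542400, 106110383822528726214010902111473575885500,
      398207737958678246460640987137226752000000, -926129570100712972092651326129660964851100,
      -2462583636239293526395581911492891394048000,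
      6011442772814938700130822986913411560190000,
      11492245494430765620974657431193301221376000,
      -29825915799563135966254117022817051374694000,
      -41120702553479512125399952400960383549440000,
      115427559220248465726612997131866774243124000,
      113693772246592590910923774521454339489792000,
      -353619179853893312590034411529532455012168000,
      -242477368537428345044849616203842318565376000,
      866492273167202239068942208501510178438046000,
      392236917160582502123956946580547236003840000,
      -1709418089232155277155067677173676025645912000,
      -457250100731858496870125487919370143531008000,
      2723549786416908270731347181528549375389779000,
      320649889440234892214259169705213135552512000,
      -3503335999255324781479633841923844117817759000,
      18296439368813023064044209832163206103040000,
      3623481689106110300311868805556121409122058000,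
      -389587536837413347540570215833601388707840000,
      -2988026484791532135981448987323840854780010000,
      578546241029676645263360740374694351994880000,
      1936710845936658610643286322517708562911400000,
      -516812052892751880786554973035857374412800000,
      -964647487566685230376065156391260138610500000,
      318050456340852336080634184261959135068160000,
      356228794794645313941508280152801697126250000,
      -136830089225967037176820324271379285196800000,
      -91843175120279593024066824706544281546875000,
      39634312154731884386337421229584435200000000,
      14753714791295509156779295939240174917187500,
      -6981266747802266237518350230336256000000000,
      -1111514951094207850709198350159293492187500,
      566840980338857453740897945278720000000000],
    [0, -2097152, 2097152, -776729629652757250048, 1553469162301618651136,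
      1624934914472402913585922048, -3253857484485728711139655680,
      -13817790046309943679077325864960, 27784702483013433892187305672704,
      11425313680728839745045269211316224, -23103927176523437152716008089190400,
      -2458229674716935210739127054030848000, 5007351210132521128573587253761146880,
      213702983768178281466972763187711040000, -439642462428274484993877605673294888960,
      -9514804007599279483034224892750578652160, 19839239981513433710650443873413738004480,
      250356763437133419361940966805178081779840, -531371286541324668999579478619575261593600,
      -4273207796712263076619078554582986004436080,
      9279538451467064263975020565105619317555200,
      50430076881403424482922129233201232889892650,
      -112723474619297923633209916068349339002470400,
      -430484101186598821716712880935543231184814150,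
      997627971996976343218970839928269028956569600,
      2745460572543818250750096015863112679298002950,
      -6655118464664079608642092994151531029200896000,
      -13386609700972739329528718087396297359135891050,
      34323712693684731564240866957921861402886144000,
      50685769615870751487232994232926719859951704200,
      -139491722987351592090724076346190654534582272000,
      -150340692418559388801172520851473203372381187000,
      453071517543701399764468881443021665834893312000,
      349808326171483017995603247093721976567922903000,
      -1188210695968201145436597246509090170900316160000,
      -632683041063705316778311963074063673712281509000,
      2533532103266644208048267765768466117993431040000,
      863904123841584330823990193143114687821358231500,
      -4409203424833778276695030273348474774062366720000,
      -817512732488194885440807208158192482073597772500,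
      6269477435384588476556598590645036195056189440000,
      358381906614923458593585425707648283148224752500,
      -7268871345618646527596933747408238523318272000000,
      362744923363705868580707537154420042045726532500,
      6834628874525036179285942701837915132238233600000,
      -958859469314526686587538953125115932610298535000,
      -5161877717829244329572750968538638308566630400000,
      1122032828481160274877662204870210795102774385000,
      3084272018799985385839740504826620307125043200000,
      -874939103993128045091973652039982594444656965000,
      -1424349817462573160480323867644257108606976000000,
      485963209582049317925532088855375459064614125000,
      490174387819379313462587217968257812480000000000,
      -191861440247958720902947653751212970795749843750,
      -118308481722858015956546300886639114240000000000,
      51533188857062551555913661357719751434866406250,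
      17864326581132075303337068830514554880000000000,
      -8479363704498074856309163453040840027753906250,
      -1269723795959040696379611397424332800000000000,
      646802010046780232805952109214404191277343750]]

/-- The generating function of the `r`-th moments of the doubled area, for `r ≤ 20`. -/
def momentForm (r : ℕ) : CatForm := ⟨2 ^ r, momentPols.getD r []⟩

/-- The moment recursion up to order `20`, checked by evaluating both sides. -/
lemma momentForm_satisfiesRecursion :
    ∀ r ≤ 20, CatForm.satisfiesRecursion momentForm r = true := by
  have h : ∀ r < 21, CatForm.satisfiesRecursion momentForm r = true := by decide +kernel
  exact fun r hr => h r (Nat.lt_succ_of_le hr)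

/-! ### From polynomials in `u` to polynomials in `n` -/

/-- The value at `x` of the polynomial with a given coefficient list. -/
def listEval (x : ℚ) : List ℤ → ℚ
  | [] => 0
  | a :: p => a + x * listEval x p

lemma eval_polyOfCoeffs (d : ℕ) (a : List ℤ) (x : ℚ) :
    (polyOfCoeffs d a).eval x = listEval x a / d := by
  have h : ∑ i ∈ Finset.range a.length, ((a.getD i 0 : ℤ) : ℚ) * x ^ i = listEval x a := by
    induction a with
    | nil => rfl
    | cons c a ih =>
      rw [List.length_cons, Finset.sum_range_succ', listEval, ← ih, Finset.mul_sum, add_comm]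
      congr 1
      · simp
      · refine Finset.sum_congr rfl fun i _ => ?_
        rw [List.getD_cons_succ]
        ring
  simp only [polyOfCoeffs, Polynomial.eval_mul, Polynomial.eval_C, Polynomial.eval_finsetSum,
    Polynomial.eval_pow, Polynomial.eval_X]
  rw [h]
  ring

namespace CatForm

/-- For a polynomial `a` of length `j`, encodes the series whose `n`-th coefficient is `2 ^ j a(n)`
times that of `g`; the power of two makes the coefficients integral. -/
def applyPoly (g : CatForm) : List ℤ → CatForm
  | [] => ⟨0, []⟩
  | a :: p => (applyPoly g p).force fun s => s.euler.add (g.smul (2 ^ (p.length + 1) * a))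

lemma coeff_applyPoly (g : CatForm) (a : List ℤ) (n : ℕ) :
    PowerSeries.coeff n (g.applyPoly a).toSeries =
      2 ^ a.length * listEval n a * PowerSeries.coeff n g.toSeries := by
  induction a with
  | nil => simp [applyPoly, toSeries, polSeries, listEval]
  | cons a p ih =>
    rw [applyPoly, force_eq, toSeries_add, toSeries_euler, map_add, coeff_eulerDeriv, ih,
      toSeries_smul, coeff_intCast_mul, List.length_cons, listEval]
    push_cast
    ring

/-- The test that the series encoded by `f` is `2 ^ r` times the generating function of
`(a(n) / d) * catalan n + (b(n) / e) * 4 ^ n`, with denominators cleared. It uses that `u²` is the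
generating function of `4 ^ n`. -/
def isClosedForm (f : CatForm) (r d : ℕ) (a : List ℤ) (e : ℕ) (b : List ℤ) : Bool :=
  ((((applyPoly ⟨1, []⟩ a).smul (2 ^ r * e * 2 ^ b.length)).add
    ((applyPoly ⟨0, [0, 0, 1]⟩ b).smul (2 ^ r * d * 2 ^ a.length))).add
      (f.smul (-(d * e * 2 ^ a.length * 2 ^ b.length)))).force fun s =>
        s.cat == 0 && s.pol.all (· == 0)

lemma coeff_toSeries_of_isClosedForm {f : CatForm} {r d : ℕ} {a : List ℤ} {e : ℕ} {b : List ℤ}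
    (hd : d ≠ 0) (he : e ≠ 0) (h : f.isClosedForm r d a e b = true) (n : ℕ) :
    PowerSeries.coeff n f.toSeries =
      2 ^ r * (listEval n a / d * catalan n + listEval n b / e * 4 ^ n) := by
  rw [isClosedForm, force_eq, Bool.and_eq_true, beq_iff_eq] at h
  obtain ⟨hc, hp⟩ := h
  have hs := congrArg (PowerSeries.coeff n) (congrArg₂
    (fun c p : PowerSeries ℚ => c * catSeries + p) (congrArg (Int.cast (R := PowerSeries ℚ)) hc) (polSeries_eq_zero hp))
  have hcat : (⟨1, []⟩ : CatForm).toSeries = catSeries := by simp [toSeries, polSeries]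
  have hsq : (⟨0, [0, 0, 1]⟩ : CatForm).toSeries = invSqrtSeries ^ 2 := by
    simp [toSeries, polSeries, sq]
  change PowerSeries.coeff n (toSeries _) = _ at hs
  simp only [toSeries_add, toSeries_smul, map_add, coeff_intCast_mul, coeff_applyPoly, hcat, hsq,
    coeff_invSqrtSeries_sq] at hs
  have hn : PowerSeries.coeff n catSeries = catalan n := by simp [catSeries]
  rw [hn] at hs
  push_cast at hs
  simp only [zero_mul, zero_add, map_zero] at hs
  have hd : (d : ℚ) ≠ 0 := Nat.cast_ne_zero.2 hd
  have he : (e : ℚ) ≠ 0 := Nat.cast_ne_zero.2 he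
  have h2 : (2 : ℚ) ^ a.length * 2 ^ b.length ≠ 0 := by positivity
  field_simp
  apply mul_left_cancel₀ h2
  linear_combination -hs

end CatForm

lemma catalan_eq_factorial_div (n : ℕ) :
    (catalan n : ℚ) =
      ((2 * n).factorial : ℚ) / ((n.factorial : ℚ) * ((n + 1).factorial : ℚ)) := by
  have h1 : ((n : ℚ) + 1) * catalan n = n.centralBinom := by
    exact_mod_cast succ_mul_catalan_eq_centralBinom n
  have h2 : (n.centralBinom : ℚ) * n.factorial * n.factorial = (2 * n).factorial := by
    have := Nat.choose_mul_factorial_mul_factorial (show n ≤ 2 * n by omega)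
    rw [show 2 * n - n = n by omega] at this
    exact_mod_cast this
  have h3 : (n.factorial : ℚ) ≠ 0 := by positivity
  rw [Nat.factorial_succ, ← h2, ← h1]
  push_cast
  field_simp

/-- A closed form for the `r`-th moment that passes the test against the `r`-th moment series. -/
theorem dyckAreaPowerSum_eq_of_isClosedForm {r d : ℕ} {a : List ℤ} {e : ℕ} {b : List ℤ}
    (hr : r ≤ 20) (hd : d ≠ 0) (he : e ≠ 0)
    (h : (momentForm r).isClosedForm r d a e b = true) (n : ℕ) :
    dyckAreaPowerSum r n = listEval n a / d *
        (((2 * n).factorial : ℚ) / ((n.factorial : ℚ) * ((n + 1).factorial : ℚ))) +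
      listEval n b / e * 4 ^ n := by
  have h1 := CatForm.coeff_toSeries_eq_doubledMoment momentForm_satisfiesRecursion n r hr
  rw [CatForm.coeff_toSeries_of_isClosedForm hd he h, doubledMoment,
    catalan_eq_factorial_div] at h1
  exact (mul_left_cancel₀ (by positivity) h1).symm

lemma dyckAreaPowerSum_eq_of_polyOfCoeffs {r d : ℕ} {a : List ℤ} {e : ℕ} {b : List ℤ}
    {A B : Polynomial ℚ} (hA : A = polyOfCoeffs d a) (hB : B = polyOfCoeffs e b)
    (hr : r ≤ 20) (hd : d ≠ 0) (he : e ≠ 0)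
    (h : (momentForm r).isClosedForm r d a e b = true) (n : ℕ) :
    dyckAreaPowerSum r n = A.eval (n : ℚ) *
        (((2 * n).factorial : ℚ) / ((n.factorial : ℚ) * ((n + 1).factorial : ℚ))) +
      B.eval (n : ℚ) * 4 ^ n := by
  rw [dyckAreaPowerSum_eq_of_isClosedForm hr hd he h, hA, hB, eval_polyOfCoeffs,
    eval_polyOfCoeffs]

/-! ### The closed forms -/

theorem mainTheorem1 :
    (∀ n : ℕ, dyckAreaPowerSum 1 n =
      (-2 * (n : ℚ) - 1) *
          (((2 * n).factorial : ℚ) / ((n.factorial : ℚ) * ((n + 1).factorial : ℚ))) +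
        4 ^ n) ∧
    (∀ n : ℕ, dyckAreaPowerSum 2 n =
      (10 / 3 * (n : ℚ) ^ 3 + 11 * (n : ℚ) ^ 2 + 26 / 3 * (n : ℚ) + 2) *
          (((2 * n).factorial : ℚ) / ((n.factorial : ℚ) * ((n + 1).factorial : ℚ))) +
        (-4 * (n : ℚ) - 2) * 4 ^ n) ∧
    (∀ n : ℕ, dyckAreaPowerSum 3 n =
      (-20 * (n : ℚ) ^ 4 - 60 * (n : ℚ) ^ 3 - 61 * (n : ℚ) ^ 2 - 26 * (n : ℚ) - 4) *
          (((2 * n).factorial : ℚ) / ((n.factorial : ℚ) * ((n + 1).factorial : ℚ))) +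
        (15 / 4 * (n : ℚ) ^ 3 + 75 / 4 * (n : ℚ) ^ 2 + 33 / 2 * (n : ℚ) + 4) * 4 ^ n) ∧
    (∀ n : ℕ, dyckAreaPowerSum 4 n =
      (884 / 63 * (n : ℚ) ^ 6 + 4568 / 35 * (n : ℚ) ^ 5 + 108043 / 315 * (n : ℚ) ^ 4 +
        14016 / 35 * (n : ℚ) ^ 3 + 74332 / 315 * (n : ℚ) ^ 2 + 2416 / 35 * (n : ℚ) + 8) *
          (((2 * n).factorial : ℚ) / ((n.factorial : ℚ) * ((n + 1).factorial : ℚ))) +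
        (-30 * (n : ℚ) ^ 4 - 101 * (n : ℚ) ^ 3 - 111 * (n : ℚ) ^ 2 - 50 * (n : ℚ) - 8) * 4 ^ n) ∧
    (∀ n : ℕ, dyckAreaPowerSum 5 n =
      (-8840 / 63 * (n : ℚ) ^ 7 - 53044 / 63 * (n : ℚ) ^ 6 - 128174 / 63 * (n : ℚ) ^ 5 -
        162091 / 63 * (n : ℚ) ^ 4 - 116888 / 63 * (n : ℚ) ^ 3 - 48520 / 63 * (n : ℚ) ^ 2 -
        3608 / 21 * (n : ℚ) - 16) *
          (((2 * n).factorial : ℚ) / ((n.factorial : ℚ) * ((n + 1).factorial : ℚ))) +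
        (565 / 32 * (n : ℚ) ^ 6 + 6495 / 32 * (n : ℚ) ^ 5 + 18485 / 32 * (n : ℚ) ^ 4 +
          22825 / 32 * (n : ℚ) ^ 3 + 7035 / 16 * (n : ℚ) ^ 2 + 535 / 4 * (n : ℚ) + 16) * 4 ^ n) ∧
    (∀ r : ℕ, 6 ≤ r → r ≤ 20 → ∀ n : ℕ, dyckAreaPowerSum r n =
      (catalanPart r).eval (n : ℚ) *
          (((2 * n).factorial : ℚ) / ((n.factorial : ℚ) * ((n + 1).factorial : ℚ))) +
        (fourPowPart r).eval (n : ℚ) * 4 ^ n) := by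
  refine ⟨fun n => ?_, fun n => ?_, fun n => ?_, fun n => ?_, fun n => ?_, fun r h6 h20 n => ?_⟩
  · rw [dyckAreaPowerSum_eq_of_isClosedForm (r := 1) (d := 1) (a := [-1, -2]) (e := 1) (b := [1])
      (by norm_num) (by norm_num) (by norm_num) (by decide +kernel)]
    simp only [listEval]; push_cast; ring
  · rw [dyckAreaPowerSum_eq_of_isClosedForm (r := 2) (d := 3) (a := [6, 26, 33, 10]) (e := 1)
      (b := [-2, -4]) (by norm_num) (by norm_num) (by norm_num) (by decide +kernel)]
    simp only [listEval]; push_cast; ring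
  · rw [dyckAreaPowerSum_eq_of_isClosedForm (r := 3) (d := 1) (a := [-4, -26, -61, -60, -20])
      (e := 4) (b := [16, 66, 75, 15]) (by norm_num) (by norm_num) (by norm_num)
      (by decide +kernel)]
    simp only [listEval]; push_cast; ring
  · rw [dyckAreaPowerSum_eq_of_isClosedForm (r := 4) (d := 315)
      (a := [2520, 21744, 74332, 126144, 108043, 41112, 4420])
      (e := 1) (b := [-8, -50, -111, -101, -30]) (by norm_num) (by norm_num) (by norm_num)
      (by decide +kernel)]
    simp only [listEval]; push_cast; ring
  · rw [dyckAreaPowerSum_eq_of_isClosedForm (r := 5) (d := 63)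
      (a := [-1008, -10824, -48520, -116888, -162091, -128174, -53044, -8840])
      (e := 32) (b := [512, 4280, 14070, 22825, 18485, 6495, 565]) (by norm_num) (by norm_num)
      (by norm_num) (by decide +kernel)]
    simp only [listEval]; push_cast; ring
  · interval_cases r <;>
      exact dyckAreaPowerSum_eq_of_polyOfCoeffs rfl rfl (by norm_num) (by norm_num) (by norm_num)
        (by decide +kernel) n
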